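/- **Setting.** Let $n\ge 1$ and $0\le k\le n$. Let $X=(X_1,\dots,X_n)$ have independent entries, where $X_i\sim f_2$ for $i$ in an unknown set $K$ of size $k$ and $X_i\sim f_1$ otherwise ($f_1,f_2$ are known probability laws on $\mathbb R$). The hypotheses $H_v$, $1\le v\le l=\binom nk$, are the possible sets $K$. With sensing vector $a\in\mathbb R^n$ one observes $Y=\langle a,X\rangle$, whose law under $H_v$ is denoted $P_{v}^{a}$; realizations of $X$ at different times are independent. For probability laws $P,Q$ with densities $p,q$ with respect to a common dominating measure, the Chernoff information is $C(P,Q)=-\inf_{0\le\lambda\le1}\log\int p^\lambda q^{1-\lambda}$. For a Borel probability measure $p_A$ on $\mathbb R^n$, the outer conditional Chernoff information of $H_v,H_w$ is $$OC_{v,w}(p_A)=-\inf_{0\le\lambda\le 1}\int \log\Big(\int (p_v^{a})^{\lambda}(p_w^{a})^{1-\lambda}\Big)\,dp_A(a)\in[0,\infty],$$ where $p^a_v,p^a_w$ are the densities of $P^a_v,P^a_w$. Put $m(p_A)=\min_{v\ne w}OC_{v,w}(p_A)$ ($=\infty$ if there is only one hypothesis). For a finitely supported $p_A$, a deterministic time-varying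 measurement scheme with distribution $p_A$ prescribes, for each number $m$ of measurements, sensing vectors $a^1,\dots,a^m$ that are atoms of $p_A$, such that for each $b$ the fraction of the $m$ measurements using $b$ tends to $p_A(\{b\})$ as $m\to\infty$. Let $P_e(m)$ be the smallest worst-case (over the true hypothesis) probability of error of a decision rule based on $Y^1,\dots,Y^m$. The error exponent of $p_A$ is $\lim_{m\to\infty}-\frac1m\log P_e(m)$. **Theorem.** 1. For every finitely supported probability measure $p_A$ on $\mathbb R^n$, schemes with distribution $p_A$ exist, and the error exponent exists, is the same for all of them, and equals $m(p_A)$. Such a $p_A$ maximizes the error exponent among all finitely supported probability measures if and only if it maximizes $m$ among all Borel probability measures on $\mathbb R^n$. 2. Let $k=1$, $f_1=\mathcal N(\mu_2,\sigma^2)$, $f_2=\mathcal N(\mu_1,\sigma^2)$ with $\sigma^2>0$. If $a^*\in\mathbb R^n$ maximizes $a\mapsto\sum_{v\neq w}C(P_v^{a},P_w^{a})$, then $$p_A^*=\frac1{n!}\sum_{\tau\in S_n}\delta_{\tau(a^*)}$$ (where $\tau$ permutes coordinates) maximizes $m$ among all Borel probability measures on $\mathbb R^n$, and maximizes the error exponent.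 3. In the situation of 2, if $n\ge2$, then $a^*=(\tfrac1{\sqrt2},-\tfrac1{\sqrt2},0,\dots,0)$ is such a maximizer; the error exponent of the corresponding $p_A^*$ is $\frac{(\mu_1-\mu_2)^2}{4\sigma^2(n-1)}$, which is $\frac n{n-1}$ times the error exponent $\frac{(\mu_1-\mu_2)^2}{4\sigma^2 n}$ of separate sampling, where $p_A$ is uniform over the $n$ standard basis vectors. -/

import Mathlib

open MeasureTheory ProbabilityTheory Filter Topology
open scoped ENNReal NNReal

noncomputable section

namespace CompressedTesting

/-- The integral `∫ p^lam * q^(1 - lam)` of two probability measures `P`, `Q` on a common space, where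
`p`, `q` are their densities with respect to the dominating measure `P + Q` (the value does not
depend on the dominating measure, so Lebesgue densities may be used whenever they exist). -/
def affinity {Y : Type*} [MeasurableSpace Y] (lam : ℝ) (P Q : Measure Y) : ℝ≥0∞ :=
  ∫⁻ y, (P.rnDeriv (P + Q) y) ^ lam * (Q.rnDeriv (P + Q) y) ^ (1 - lam) ∂(P + Q)

/-- `-log x`, with `-log 0 = ∞`; used only for `x ≤ 1`, where it is nonnegative. -/
def negLog (x : ℝ≥0∞) : ℝ≥0∞ := (-ENNReal.log x).toENNReal

/-- The Chernoff information `C(P, Q) = - min_{0 ≤ lam ≤ 1} log ∫ p^lam q^(1 - lam)`. -/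
def chernoffInfo {Y : Type*} [MeasurableSpace Y] (P Q : Measure Y) : ℝ≥0∞ :=
  ⨆ lam ∈ Set.Icc (0 : ℝ) 1, negLog (affinity lam P Q)

/-- The hypotheses: the possible sets of `k` anomalous indices among `n`. -/
abbrev Hypothesis (n k : ℕ) : Type := {K : Finset (Fin n) // K.card = k}

/-- The law of the observation `⟨a, X⟩`, where `X_1, …, X_n` are independent, `X_i ∼ f₂` for the
anomalous indices `i ∈ K` and `X_i ∼ f₁` for all other indices. -/
def obsLaw {n k : ℕ} (f₁ f₂ : Measure ℝ) (K : Hypothesis n k) (a : Fin n → ℝ) : Measure ℝ :=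
  (Measure.pi fun i : Fin n => if i ∈ K.1 then f₂ else f₁).map fun x => ∑ i, a i * x i

/-- The outer conditional Chernoff information between the hypotheses `K` and `L` for a sensing
vector with distribution `p`:
`OC = - min_{0 ≤ lam ≤ 1} E_{a ∼ p} log ∫ p_{Y|a,K}^lam p_{Y|a,L}^(1 - lam)`. -/
def outerChernoff {n k : ℕ} (f₁ f₂ : Measure ℝ) (p : Measure (Fin n → ℝ))
    (K L : Hypothesis n k) : ℝ≥0∞ :=
  ⨆ lam ∈ Set.Icc (0 : ℝ) 1,
    ∫⁻ a, negLog (affinity lam (obsLaw f₁ f₂ K a) (obsLaw f₁ f₂ L a)) ∂p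

/-- The minimum of the outer conditional Chernoff information over all pairs of distinct
hypotheses. -/
def minOuterChernoff {n : ℕ} (f₁ f₂ : Measure ℝ) (k : ℕ) (p : Measure (Fin n → ℝ)) : ℝ≥0∞ :=
  ⨅ (K : Hypothesis n k) (L : Hypothesis n k) (_ : K ≠ L), outerChernoff f₁ f₂ p K L

/-- The smallest achievable worst-case error probability when the predetermined sensing vectors
`a 0, …, a (m - 1)` are used at the `m` time indices, with independent realizations of `X` at
different times: the infimum over all measurable decision rules `φ` (which may depend on `a`) of the
largest probability, over the true hypotheses `K`, that `φ (Y^1, …, Y^m) ≠ K`. -/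
def optErrorProb {n : ℕ} (f₁ f₂ : Measure ℝ) (k : ℕ) {m : ℕ} (a : Fin m → Fin n → ℝ) : ℝ≥0∞ :=
  ⨅ (φ : (Fin m → ℝ) → Hypothesis n k) (_ : ∀ K, MeasurableSet (φ ⁻¹' {K})),
    ⨆ K : Hypothesis n k, (Measure.pi fun j => obsLaw f₁ f₂ K (a j)) {y | φ y ≠ K}

/-- A deterministic time-varying measurement scheme with distribution `p`: for every number `m` of
measurements, the sensing vectors at times `1, …, m` are predetermined atoms of `p`, and each
vector `b` is used in a fraction of them that is asymptotically equal to `p {b}` (for instance in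
exactly `m * p {b}` of them whenever these are integers). -/
def IsSchemeFor {n : ℕ} (p : Measure (Fin n → ℝ)) (a : (m : ℕ) → Fin m → Fin n → ℝ) : Prop :=
  (∀ m j, p {a m j} ≠ 0) ∧
    ∀ b : Fin n → ℝ,
      Tendsto (fun m : ℕ => (Nat.card {j : Fin m // a m j = b} : ℝ) / m) atTop (𝓝 (p.real {b}))

/-- The distributions of sensing vectors that deterministic time-varying measurements can have:
finitely supported probability measures. -/
def IsFiniteDistribution {n : ℕ} (p : Measure (Fin n → ℝ)) : Prop :=
  IsProbabilityMeasure p ∧ ∃ s : Finset (Fin n → ℝ), p (s : Set (Fin n → ℝ))ᶜ = 0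

/-- `E` is the error exponent of hypothesis testing with sensing vectors of distribution `p`: schemes
with distribution `p` exist, and for each of them the smallest achievable error probability `P_e(m)`
satisfies `-(1/m) log P_e(m) → E`. -/
def HasErrorExponent {n : ℕ} (f₁ f₂ : Measure ℝ) (k : ℕ) (p : Measure (Fin n → ℝ))
    (E : ℝ≥0∞) : Prop :=
  (∃ a, IsSchemeFor p a) ∧
    ∀ a, IsSchemeFor p a →
      Tendsto (fun m : ℕ => negLog (optErrorProb f₁ f₂ k (a m)) / m) atTop (𝓝 E)

/-- `p` maximizes the error exponent of hypothesis testing. -/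
def MaximizesErrorExponent {n : ℕ} (f₁ f₂ : Measure ℝ) (k : ℕ) (p : Measure (Fin n → ℝ)) : Prop :=
  IsFiniteDistribution p ∧
    ∃ E, HasErrorExponent f₁ f₂ k p E ∧
      ∀ q : Measure (Fin n → ℝ), IsFiniteDistribution q →
        ∀ E', HasErrorExponent f₁ f₂ k q E' → E' ≤ E

/-- `p` maximizes, among all Borel probability measures, the minimum over pairs of distinct
hypotheses of the outer conditional Chernoff information. -/
def MaximizesMinOuterChernoff {n : ℕ} (f₁ f₂ : Measure ℝ) (k : ℕ)
    (p : Measure (Fin n → ℝ)) : Prop :=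
  IsProbabilityMeasure p ∧
    ∀ q : Measure (Fin n → ℝ), IsProbabilityMeasure q →
      minOuterChernoff f₁ f₂ k q ≤ minOuterChernoff f₁ f₂ k p

/-- The sum over all pairs of distinct hypotheses of the Chernoff informations between the laws of
the observation `⟨a, X⟩`. -/
def sumChernoff {n : ℕ} (f₁ f₂ : Measure ℝ) (k : ℕ) (a : Fin n → ℝ) : ℝ≥0∞ :=
  ∑ KL ∈ (Finset.univ : Finset (Hypothesis n k)).offDiag,
    chernoffInfo (obsLaw f₁ f₂ KL.1 a) (obsLaw f₁ f₂ KL.2 a)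

/-- `a` maximizes the sum of the pairwise Chernoff informations. -/
def MaximizesSumChernoff {n : ℕ} (f₁ f₂ : Measure ℝ) (k : ℕ) (a : Fin n → ℝ) : Prop :=
  ∀ b : Fin n → ℝ, sumChernoff f₁ f₂ k b ≤ sumChernoff f₁ f₂ k a

/-- The distribution `∑_τ (1 / n!) δ_{τ(a)}`, `τ` ranging over the permutations of coordinates. -/
def permUniform {n : ℕ} (a : Fin n → ℝ) : Measure (Fin n → ℝ) :=
  (n.factorial : ℝ≥0∞)⁻¹ • ∑ τ : Equiv.Perm (Fin n), Measure.dirac fun i => a (τ i)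

/-- Separate sampling: each of the `n` variables is observed individually, equally often. -/
def separateSampling (n : ℕ) : Measure (Fin n → ℝ) :=
  (n : ℝ≥0∞)⁻¹ • ∑ i : Fin n, Measure.dirac (Pi.single i (1 : ℝ))

/-- The vector `(1/√2, -1/√2, 0, …, 0)`. -/
def twoPoint (n : ℕ) : Fin n → ℝ := fun i =>
  if i.val = 0 then 1 / √2 else if i.val = 1 then -1 / √2 else 0

end CompressedTesting

end

open CompressedTesting

namespace CompressedTesting

/-! Achievability: for two product laws, the likelihood ratio test has both errors at most the
product of the affinities, for every exponent `lam` common to all times (`exists_test`). Along a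
scheme, minus the logarithm of this product, divided by `m`, tends to the average of `negLog
(affinity ..)` under `p`. A single `lam` serves all times, hence the supremum outside the integral
in `outerChernoff`. Combining the finitely many pairwise tests costs a constant factor
(`optErrorProb_le`).

Converse: take a pair whose outer Chernoff information is below the target, and tilt all factors by
the same exponent. Chebyshev's inequality concentrates the total log-likelihood ratio, and there
both laws have a density of at least about `exp (-m * OC)` with respect to the tilted law
(`two_point_lower_bound`). This requires an exponent where the averaged cumulant generating function
is nearly stationary. The infimum may lie at an end point, so `exists_almost_stationary` weights the
derivative by the distances to the end points.

To compare with all Borel distributions, one fixes a nearly optimal `lam` for each of the finitely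
many pairs and discretizes by simple functions (`exists_finite_lt_lintegral`).

In the Gaussian case `lam = 1/2` is optimal for every sensing vector at once, so the outer Chernoff
information is an average of Chernoff informations. The minimum over pairs is at most the mean over
pairs, which is at most its value at the best `a`. Permuting the coordinates of `a` uniformly makes
all pairs equal, so this bound is attained. Its value follows from `∑ (a i - a j) ^ 2 = 2 * (n * ∑ a
l ^ 2 - (∑ a l) ^ 2)`, which for given norm is largest when the coordinates sum to zero. -/

/-! ### The extended minus logarithm -/

lemma negLog_antitone : Antitone negLog := fun _ _ h =>
  EReal.toENNReal_le_toENNReal (EReal.neg_le_neg_iff.2 (ENNReal.log_monotone h))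

@[simp] lemma negLog_zero : negLog 0 = ⊤ := by simp [negLog]

@[simp] lemma negLog_one : negLog 1 = 0 := by simp [negLog]

lemma negLog_eq_ofReal {x : ℝ≥0∞} (h0 : x ≠ 0) (ht : x ≠ ⊤) :
    negLog x = ENNReal.ofReal (-Real.log x.toReal) := by
  rw [negLog, ENNReal.log_pos_real h0 ht, ← EReal.coe_neg, EReal.real_coe_toENNReal]

lemma negLog_ofReal {x : ℝ} (hx : 0 < x) :
    negLog (ENNReal.ofReal x) = ENNReal.ofReal (-Real.log x) := by
  rw [negLog_eq_ofReal (by simpa using hx) ENNReal.ofReal_ne_top, ENNReal.toReal_ofReal hx.le]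

/-- Positivity of `s` excludes `x ≥ 1`, where `negLog` is truncated to `0` and gives no upper bound
on `x`. -/
lemma le_ofReal_exp_of_le_negLog {x : ℝ≥0∞} {s : ℝ} (hs : 0 < s)
    (h : ENNReal.ofReal s ≤ negLog x) : x ≤ ENNReal.ofReal (Real.exp (-s)) := by
  rcases eq_or_ne x 0 with rfl | h0
  · simp
  rcases eq_or_ne x ⊤ with rfl | ht
  · simp [negLog] at h
    linarith
  rw [negLog_eq_ofReal h0 ht] at h
  have h1 : s ≤ -Real.log x.toReal := by
    by_contra! hlt
    exact absurd h (not_le.2 ((ENNReal.ofReal_lt_ofReal_iff hs).2 hlt))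
  rw [← ENNReal.ofReal_toReal ht]
  refine ENNReal.ofReal_le_ofReal ?_
  rw [← Real.exp_log (ENNReal.toReal_pos h0 ht)]
  exact Real.exp_le_exp.2 (by linarith)

/-- Since `toENNReal` truncates at `0`, additivity can fail when a factor exceeds `1`. -/
lemma negLog_mul {x y : ℝ≥0∞} (hx : x ≤ 1) (hy : y ≤ 1) :
    negLog (x * y) = negLog x + negLog y := by
  have h1 : ENNReal.log x ≤ 0 := ENNReal.log_le_zero_iff.2 hx
  have h2 : ENNReal.log y ≤ 0 := ENNReal.log_le_zero_iff.2 hy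
  rw [negLog, negLog, negLog, ENNReal.log_mul_add, EReal.neg_add, sub_eq_add_neg,
    EReal.toENNReal_add]
  · simpa using EReal.neg_le_neg_iff.2 h1
  · simpa using EReal.neg_le_neg_iff.2 h2
  · right; exact (h2.trans_lt (by simp)).ne
  · left; exact (h1.trans_lt (by simp)).ne

lemma negLog_prod {ι : Type*} (s : Finset ι) {x : ι → ℝ≥0∞} (hx : ∀ i ∈ s, x i ≤ 1) :
    negLog (∏ i ∈ s, x i) = ∑ i ∈ s, negLog (x i) := by
  classical
  induction s using Finset.induction_on with
  | empty => simp
  | insert a s ha ih =>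
    rw [Finset.prod_insert ha, Finset.sum_insert ha, negLog_mul (hx a (by simp)), ih]
    · exact fun i hi => hx i (by simp [hi])
    · exact Finset.prod_le_one' fun i hi => hx i (by simp [hi])

/-! ### Product measures and the likelihood ratio test -/

section Product

variable {Y : Type*} [MeasurableSpace Y]

lemma lintegral_pi_prod {m : ℕ} (ν : Fin m → Measure Y) [∀ j, SigmaFinite (ν j)]
    (f : Fin m → Y → ℝ≥0∞) (hf : ∀ j, Measurable (f j)) :
    ∫⁻ y, ∏ j, f j (y j) ∂(Measure.pi ν) = ∏ j, ∫⁻ y, f j y ∂(ν j) := by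
  induction m with
  | zero => simp
  | succ m ih =>
    have hmp := (measurePreserving_piFinSuccAbove ν 0).symm
    rw [← hmp.lintegral_comp_emb (MeasurableEquiv.measurableEmbedding _)]
    simp only [MeasurableEquiv.piFinSuccAbove_symm_apply, Fin.prod_univ_succ, Fin.insertNthEquiv,
      Fin.insertNth_zero, Equiv.coe_fn_mk, Fin.cons_zero, Fin.cons_succ]
    have h1 : Measurable fun y : Fin m → Y => ∏ j, f j.succ (y j) :=
      Finset.measurable_prod _ fun j _ => (hf _).comp (measurable_pi_apply j)
    have h2 := lintegral_prod_mul (μ := ν 0) (ν := Measure.pi fun j : Fin m => ν j.succ)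
      (hf 0).aemeasurable h1.aemeasurable
    have h3 := ih (fun j => ν j.succ) (fun j => f j.succ) fun j => hf _
    rw [← h3]
    exact h2

lemma pi_eq_withDensity {m : ℕ} (μ ν : Fin m → Measure Y) [∀ j, SigmaFinite (μ j)]
    [∀ j, SigmaFinite (ν j)] (f : Fin m → Y → ℝ≥0∞) (hf : ∀ j, Measurable (f j))
    (h : ∀ j, μ j = (ν j).withDensity (f j)) :
    Measure.pi μ = (Measure.pi ν).withDensity fun y => ∏ j, f j (y j) := by
  refine Measure.pi_eq fun s hs => ?_
  rw [withDensity_apply _ (MeasurableSet.univ_pi hs), ← lintegral_indicator (MeasurableSet.univ_pi hs)]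
  have h1 : (Set.univ.pi s).indicator (fun y : Fin m → Y => ∏ j, f j (y j))
      = fun y => ∏ j, (s j).indicator (f j) (y j) := by
    ext y
    by_cases hy : y ∈ Set.univ.pi s
    · rw [Set.indicator_of_mem hy]
      exact Finset.prod_congr rfl fun j _ => (Set.indicator_of_mem (hy j trivial) _).symm
    · rw [Set.indicator_of_notMem hy]
      obtain ⟨j, hj⟩ : ∃ j, y j ∉ s j := by simpa [Set.mem_pi] using hy
      exact (Finset.prod_eq_zero (Finset.mem_univ j) (Set.indicator_of_notMem hj _)).symm
  rw [h1, lintegral_pi_prod _ _ fun j => (hf j).indicator (hs j)]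
  refine Finset.prod_congr rfl fun j _ => ?_
  rw [lintegral_indicator (hs j), h j, withDensity_apply _ (hs j)]

/-- Hölder's inequality. At the end points the convention `0 ^ 0 = 1` turns the integral into the
total mass of one of the measures. -/
lemma affinity_le_one {lam : ℝ} (hlam : lam ∈ Set.Icc (0 : ℝ) 1) (P Q : Measure Y)
    [IsProbabilityMeasure P] [IsProbabilityMeasure Q] : affinity lam P Q ≤ 1 := by
  have hP : P ≪ P + Q := Measure.AbsolutelyContinuous.add_right Measure.AbsolutelyContinuous.rfl _
  have hQ : Q ≪ P + Q := by
    rw [add_comm]; exact Measure.AbsolutelyContinuous.add_right Measure.AbsolutelyContinuous.rfl _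
  rcases eq_or_lt_of_le hlam.1 with h0 | h0
  · simp only [affinity, ← h0]
    simp [Measure.lintegral_rnDeriv hQ]
  rcases eq_or_lt_of_le hlam.2 with h1 | h1
  · simp only [affinity, h1]
    simp [Measure.lintegral_rnDeriv hP]
  have h := ENNReal.lintegral_mul_norm_pow_le (μ := P + Q)
    (Measure.measurable_rnDeriv P (P + Q)).aemeasurable
    (Measure.measurable_rnDeriv Q (P + Q)).aemeasurable h0.le (sub_nonneg.2 h1.le) (by ring)
  rw [Measure.lintegral_rnDeriv hQ, Measure.lintegral_rnDeriv hP] at h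
  simpa [affinity] using h

/-- The likelihood ratio test between two product measures. -/
lemma exists_test {m : ℕ} (P Q : Fin m → Measure Y) [∀ j, IsProbabilityMeasure (P j)]
    [∀ j, IsProbabilityMeasure (Q j)] :
    ∃ A : Set (Fin m → Y), MeasurableSet A ∧ ∀ lam ∈ Set.Icc (0 : ℝ) 1,
      Measure.pi P Aᶜ ≤ ∏ j, affinity lam (P j) (Q j) ∧
      Measure.pi Q A ≤ ∏ j, affinity lam (P j) (Q j) := by
  set p : Fin m → Y → ℝ≥0∞ := fun j => (P j).rnDeriv (P j + Q j) with hp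
  set q : Fin m → Y → ℝ≥0∞ := fun j => (Q j).rnDeriv (P j + Q j) with hq
  have mp : ∀ j, Measurable (p j) := fun j => Measure.measurable_rnDeriv _ _
  have mq : ∀ j, Measurable (q j) := fun j => Measure.measurable_rnDeriv _ _
  have hP : ∀ j, P j = (P j + Q j).withDensity (p j) := fun j =>
    (Measure.withDensity_rnDeriv_eq _ _
      (Measure.AbsolutelyContinuous.add_right Measure.AbsolutelyContinuous.rfl _)).symm
  have hQ : ∀ j, Q j = (P j + Q j).withDensity (q j) := fun j =>
    (Measure.withDensity_rnDeriv_eq _ _ (by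
      rw [add_comm]
      exact Measure.AbsolutelyContinuous.add_right Measure.AbsolutelyContinuous.rfl _)).symm
  have hPm := pi_eq_withDensity P (fun j => P j + Q j) p mp hP
  have hQm := pi_eq_withDensity Q (fun j => P j + Q j) q mq hQ
  have mpp : Measurable fun y : Fin m → Y => ∏ j, p j (y j) :=
    Finset.measurable_prod _ fun j _ => (mp j).comp (measurable_pi_apply j)
  have mqq : Measurable fun y : Fin m → Y => ∏ j, q j (y j) :=
    Finset.measurable_prod _ fun j _ => (mq j).comp (measurable_pi_apply j)
  have hA : MeasurableSet {y : Fin m → Y | ∏ j, q j (y j) ≤ ∏ j, p j (y j)} :=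
    measurableSet_le mqq mpp
  refine ⟨_, hA, fun lam hlam => ?_⟩
  have key : ∏ j, affinity lam (P j) (Q j) = ∫⁻ y, (∏ j, p j (y j)) ^ lam *
      (∏ j, q j (y j)) ^ (1 - lam) ∂(Measure.pi fun j => P j + Q j) := by
    have h1 := lintegral_pi_prod (fun j => P j + Q j)
      (fun j y => p j y ^ lam * q j y ^ (1 - lam)) fun j =>
      ((mp j).pow_const _).mul ((mq j).pow_const _)
    simp only [affinity]
    rw [← h1]
    refine lintegral_congr fun y => ?_
    rw [Finset.prod_mul_distrib, ENNReal.prod_rpow_of_nonneg hlam.1,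
      ENNReal.prod_rpow_of_nonneg (sub_nonneg.2 hlam.2)]
  rw [key]
  -- Where one density is the smaller one, replacing one of the two factors of this splitting by the
  -- power of the larger density bounds it by the integrand of the affinity.
  have split : ∀ x : ℝ≥0∞, x = x ^ lam * x ^ (1 - lam) := fun x => by
    rw [← ENNReal.rpow_add_of_nonneg _ _ hlam.1 (sub_nonneg.2 hlam.2)]
    simp
  constructor
  · rw [hPm, withDensity_apply _ hA.compl]
    refine (setLIntegral_mono' hA.compl fun y hy => ?_).trans (setLIntegral_le_lintegral _ _)
    have hy' : ∏ j, p j (y j) ≤ ∏ j, q j (y j) := le_of_not_ge fun h => hy h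
    conv_lhs => rw [split (∏ j, p j (y j))]
    gcongr
    linarith [hlam.2]
  · rw [hQm, withDensity_apply _ hA]
    refine (setLIntegral_mono' hA fun y hy => ?_).trans (setLIntegral_le_lintegral _ _)
    have hy' : ∏ j, q j (y j) ≤ ∏ j, p j (y j) := hy
    conv_lhs => rw [split (∏ j, q j (y j))]
    gcongr
    exact hlam.1

end Product

/-! ### From pairwise tests to a decision rule -/

instance obsLaw_isProbabilityMeasure {n k : ℕ} (f₁ f₂ : Measure ℝ) [IsProbabilityMeasure f₁]
    [IsProbabilityMeasure f₂] (K : Hypothesis n k) (a : Fin n → ℝ) :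
    IsProbabilityMeasure (obsLaw f₁ f₂ K a) := by
  have : ∀ i : Fin n, IsProbabilityMeasure (if i ∈ K.1 then f₂ else f₁) := fun i => by
    split_ifs <;> infer_instance
  exact Measure.isProbabilityMeasure_map (Measurable.aemeasurable (by fun_prop))

lemma nonempty_hypothesis {n k : ℕ} (hk : k ≤ n) : Nonempty (Hypothesis n k) := by
  obtain ⟨s, -, hs⟩ := Finset.exists_subset_card_eq (s := (Finset.univ : Finset (Fin n))) (n := k)
    (by simpa using hk)
  exact ⟨⟨s, hs⟩⟩

lemma optErrorProb_le {n k : ℕ} (hk : k ≤ n) (f₁ f₂ : Measure ℝ) {m : ℕ} (a : Fin m → Fin n → ℝ)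
    (e : ℝ≥0∞)
    (h : ∀ K L : Hypothesis n k, K ≠ L → ∃ A : Set (Fin m → ℝ), MeasurableSet A ∧
      (Measure.pi fun j => obsLaw f₁ f₂ K (a j)) Aᶜ ≤ e ∧
      (Measure.pi fun j => obsLaw f₁ f₂ L (a j)) A ≤ e) :
    optErrorProb f₁ f₂ k a ≤ Fintype.card (Hypothesis n k) * (2 * e) := by
  classical
  obtain ⟨K₀⟩ := nonempty_hypothesis hk
  choose! A mA hA1 hA2 using h
  -- `B K` is the event that `K` wins all its comparisons. The tests for `(K, L)` and `(L, K)` are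
  -- chosen independently and need not be complementary; requiring both makes the sets `B K`
  -- disjoint and causes the factor `2`.
  set B : Hypothesis n k → Set (Fin m → ℝ) := fun K =>
    ⋂ L, if K ≠ L then A K L ∩ (A L K)ᶜ else Set.univ with hB
  have mB : ∀ K, MeasurableSet (B K) := fun K => MeasurableSet.iInter fun L => by
    split_ifs with hKL
    · exact (mA _ _ hKL).inter (mA _ _ hKL.symm).compl
    · exact MeasurableSet.univ
  have uniq : ∀ K L y, y ∈ B K → y ∈ B L → K = L := fun K L y hK hL => by
    by_contra hne
    have h1 := Set.mem_iInter.1 hK L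
    have h2 := Set.mem_iInter.1 hL K
    rw [if_pos hne] at h1
    rw [if_pos (Ne.symm hne)] at h2
    exact h2.2 h1.1
  -- If no hypothesis wins all its comparisons, the answer is arbitrary; a fixed `K₀` keeps the rule
  -- measurable.
  set φ : (Fin m → ℝ) → Hypothesis n k := fun y =>
    if hy : ∃ K, y ∈ B K then hy.choose else K₀ with hφ
  have φB : ∀ K y, y ∈ B K → φ y = K := fun K y hy => by
    have hex : ∃ K, y ∈ B K := ⟨K, hy⟩
    simp only [hφ, dif_pos hex]
    exact uniq _ _ y hex.choose_spec hy
  have φ0 : ∀ y, (¬ ∃ K, y ∈ B K) → φ y = K₀ := fun y hy => by simp only [hφ, dif_neg hy]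
  have mφ : ∀ K, MeasurableSet (φ ⁻¹' {K}) := fun K => by
    by_cases hK : K = K₀
    · have : φ ⁻¹' {K} = B K ∪ (⋃ L, B L)ᶜ := by
        ext y
        simp only [Set.mem_preimage, Set.mem_singleton_iff, Set.mem_union, Set.mem_compl_iff,
          Set.mem_iUnion]
        constructor
        · intro hy
          by_cases hex : ∃ L, y ∈ B L
          · obtain ⟨L, hL⟩ := hex
            rw [φB L y hL] at hy
            exact Or.inl (hy ▸ hL)
          · exact Or.inr hex
        · rintro (hy | hy)
          · exact φB _ _ hy
          · rw [φ0 y hy, hK]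
      rw [this]
      exact (mB K).union (MeasurableSet.iUnion mB).compl
    · have : φ ⁻¹' {K} = B K := by
        ext y
        simp only [Set.mem_preimage, Set.mem_singleton_iff]
        constructor
        · intro hy
          by_cases hex : ∃ L, y ∈ B L
          · obtain ⟨L, hL⟩ := hex
            rw [φB L y hL] at hy
            exact hy ▸ hL
          · exact absurd (hy.symm.trans (φ0 y hex)) hK
        · exact φB _ _
      rw [this]
      exact mB K
  refine (iInf₂_le φ mφ).trans (iSup_le fun K => ?_)
  have hsub : {y | φ y ≠ K} ⊆ ⋃ L, if K ≠ L then (A K L)ᶜ ∪ A L K else ∅ := fun y hy => by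
    have hy' : y ∉ B K := fun hyB => hy (φB K y hyB)
    simp only [hB, Set.mem_iInter, not_forall] at hy'
    obtain ⟨L, hL⟩ := hy'
    refine Set.mem_iUnion.2 ⟨L, ?_⟩
    by_cases hKL : K ≠ L
    · rw [if_pos hKL] at hL ⊢
      by_cases h1 : y ∈ A K L
      · exact Or.inr (by_contra fun h2 => hL ⟨h1, h2⟩)
      · exact Or.inl h1
    · rw [if_neg hKL] at hL
      exact absurd trivial hL
  refine (measure_mono hsub).trans ((measure_iUnion_fintype_le _ _).trans ?_)
  refine (Finset.sum_le_card_nsmul _ _ (2 * e) fun L _ => ?_).trans (by simp)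
  split_ifs with hKL
  · rw [two_mul]
    exact (measure_union_le _ _).trans (add_le_add (hA1 K L hKL) (hA2 L K hKL.symm))
  · simp

/-! ### Lower bound on the errors by tilting -/

section Converse

variable {Y : Type*} [MeasurableSpace Y]

/-- On the set `G`, the measures `P` and `Q` are equivalent and `X` is the log-likelihood ratio;
outside of `G` they are mutually singular. -/
structure IsLogLikelihoodRatio (P Q : Measure Y) (G : Set Y) (X : Y → ℝ) : Prop where
  measurable : Measurable X
  measurableSet : MeasurableSet G
  withDensity_eq : (Q.restrict G).withDensity (fun y => ENNReal.ofReal (Real.exp (X y)))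
    = P.restrict G
  integrable : ∀ lam ∈ Set.Ioo (0 : ℝ) 1, Integrable (fun y => Real.exp (lam * X y)) (Q.restrict G)
  affinity_eq : ∀ lam ∈ Set.Ioo (0 : ℝ) 1,
    affinity lam P Q = ENNReal.ofReal (mgf X (Q.restrict G) lam)

/-- `G` is the set where both densities are positive and finite. For `0 < lam < 1` the integrand of
the affinity vanishes almost everywhere off `G`, so the affinity is a moment generating function.
This can fail at the end points, where the singular parts contribute. -/
lemma exists_isLogLikelihoodRatio (P Q : Measure Y) [IsProbabilityMeasure P]
    [IsProbabilityMeasure Q] : ∃ G X, IsLogLikelihoodRatio P Q G X := by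
  set p : Y → ℝ≥0∞ := P.rnDeriv (P + Q) with hp
  set q : Y → ℝ≥0∞ := Q.rnDeriv (P + Q) with hq
  have mp : Measurable p := Measure.measurable_rnDeriv _ _
  have mq : Measurable q := Measure.measurable_rnDeriv _ _
  have hP : P = (P + Q).withDensity p :=
    (Measure.withDensity_rnDeriv_eq _ _
      (Measure.AbsolutelyContinuous.add_right Measure.AbsolutelyContinuous.rfl _)).symm
  have hQ : Q = (P + Q).withDensity q :=
    (Measure.withDensity_rnDeriv_eq _ _ (by
      rw [add_comm]
      exact Measure.AbsolutelyContinuous.add_right Measure.AbsolutelyContinuous.rfl _)).symm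
  set G : Set Y := {y | (p y ≠ 0 ∧ p y ≠ ⊤) ∧ (q y ≠ 0 ∧ q y ≠ ⊤)} with hG
  set X : Y → ℝ := fun y => Real.log ((p y).toReal / (q y).toReal) with hX
  have mX : Measurable X := (mp.ennreal_toReal.div mq.ennreal_toReal).log
  have s1 : ∀ (f : Y → ℝ≥0∞) (c : ℝ≥0∞), Measurable f → MeasurableSet {y | f y ≠ c} :=
    fun f c hf => (hf (measurableSet_singleton c)).compl
  have mG : MeasurableSet G :=
    ((s1 p 0 mp).inter (s1 p ⊤ mp)).inter ((s1 q 0 mq).inter (s1 q ⊤ mq))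
  have hexp : ∀ y ∈ G, Real.exp (X y) = (p y).toReal / (q y).toReal := fun y hy =>
    Real.exp_log (div_pos (ENNReal.toReal_pos hy.1.1 hy.1.2) (ENNReal.toReal_pos hy.2.1 hy.2.2))
  have hPG : P.restrict G = ((P + Q).restrict G).withDensity p := by
    conv_lhs => rw [hP]
    rw [restrict_withDensity mG]
  have hQG : Q.restrict G = ((P + Q).restrict G).withDensity q := by
    conv_lhs => rw [hQ]
    rw [restrict_withDensity mG]
  have mE : ∀ lam : ℝ, Measurable fun y => ENNReal.ofReal (Real.exp (lam * X y)) := fun lam =>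
    (Real.measurable_exp.comp (mX.const_mul lam)).ennreal_ofReal
  have hpow : ∀ lam : ℝ, ∀ y ∈ G,
      q y * ENNReal.ofReal (Real.exp (lam * X y)) = p y ^ lam * q y ^ (1 - lam) := by
    intro lam y hy
    have h1 := ENNReal.toReal_pos hy.1.1 hy.1.2
    have h2 := ENNReal.toReal_pos hy.2.1 hy.2.2
    rw [mul_comm lam, Real.exp_mul, hexp y hy, ← ENNReal.ofReal_rpow_of_pos (div_pos h1 h2),
      ENNReal.ofReal_div_of_pos h2, ENNReal.ofReal_toReal hy.1.2, ENNReal.ofReal_toReal hy.2.2,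
      ENNReal.div_eq_inv_mul, ENNReal.mul_rpow_of_ne_top (ENNReal.inv_ne_top.2 hy.2.1) hy.1.2,
      ENNReal.inv_rpow, sub_eq_add_neg, ENNReal.rpow_add _ _ hy.2.1 hy.2.2, ENNReal.rpow_one,
      ENNReal.rpow_neg]
    ring
  have hlint : ∀ lam ∈ Set.Ioo (0 : ℝ) 1,
      ∫⁻ y, ENNReal.ofReal (Real.exp (lam * X y)) ∂(Q.restrict G) = affinity lam P Q := by
    intro lam hlam
    rw [affinity, ← lintegral_add_compl (μ := P + Q) _ mG]
    have h0 : ∫⁻ y in Gᶜ, p y ^ lam * q y ^ (1 - lam) ∂(P + Q) = 0 := by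
      rw [← lintegral_zero (μ := (P + Q).restrict Gᶜ)]
      refine lintegral_congr_ae ?_
      rw [Filter.EventuallyEq, ae_restrict_iff' mG.compl]
      filter_upwards [Measure.rnDeriv_lt_top P (P + Q), Measure.rnDeriv_lt_top Q (P + Q)]
        with y h1 h2 hy
      have h3 : p y = 0 ∨ q y = 0 := by
        by_contra! hcon
        exact hy ⟨⟨hcon.1, h1.ne⟩, ⟨hcon.2, h2.ne⟩⟩
      rcases h3 with h3 | h3
      · simp [h3, ENNReal.zero_rpow_of_pos hlam.1]
      · simp [h3, ENNReal.zero_rpow_of_pos (sub_pos.2 hlam.2)]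
    rw [h0, add_zero, hQG, lintegral_withDensity_eq_lintegral_mul _ mq (mE lam)]
    exact setLIntegral_congr_fun mG fun y hy => hpow lam y hy
  have hint : ∀ lam ∈ Set.Ioo (0 : ℝ) 1,
      Integrable (fun y => Real.exp (lam * X y)) (Q.restrict G) := by
    intro lam hlam
    refine ⟨(Real.measurable_exp.comp (mX.const_mul lam)).aestronglyMeasurable, ?_⟩
    rw [hasFiniteIntegral_iff_ofReal (ae_of_all _ fun _ => (Real.exp_pos _).le), hlint lam hlam]
    exact (affinity_le_one ⟨hlam.1.le, hlam.2.le⟩ P Q).trans_lt ENNReal.one_lt_top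
  refine ⟨G, X, mX, mG, ?_, hint, fun lam hlam => ?_⟩
  · rw [hQG, hPG, ← withDensity_mul _ mq (by simpa using mE 1)]
    refine withDensity_congr_ae ?_
    rw [Filter.EventuallyEq, ae_restrict_iff' mG]
    refine ae_of_all _ fun y hy => ?_
    have := hpow 1 y hy
    simpa using this
  · rw [mgf, ofReal_integral_eq_lintegral_ofReal (hint lam hlam)
      (ae_of_all _ fun _ => (Real.exp_pos _).le), hlint lam hlam]

/-- Gives analyticity of the cumulant generating function and all moments under the tilted law. -/
lemma IsLogLikelihoodRatio.mem_interior {P Q : Measure Y} {G : Set Y} {X : Y → ℝ}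
    (h : IsLogLikelihoodRatio P Q G X) {lam : ℝ} (hlam : lam ∈ Set.Ioo (0 : ℝ) 1) :
    lam ∈ interior (integrableExpSet X (Q.restrict G)) :=
  interior_mono (fun t ht => h.integrable t ht) (by rwa [isOpen_Ioo.interior_eq])

/-- The converse for a test between two product measures, by an exponential change of measure. -/
lemma two_point_lower_bound {m : ℕ} (P Q : Fin m → Measure Y) [∀ j, IsProbabilityMeasure (P j)]
    [∀ j, IsProbabilityMeasure (Q j)] (G : Fin m → Set Y) (X : Fin m → Y → ℝ)
    (h : ∀ j, IsLogLikelihoodRatio (P j) (Q j) (G j) (X j))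
    (hne : ∀ j, Q j (G j) ≠ 0) {lam : ℝ} (hlam : lam ∈ Set.Ioo (0 : ℝ) 1) {c d : ℝ} (hd : 0 < d)
    (h1 : lam * ∑ j, deriv (cgf (X j) ((Q j).restrict (G j))) lam ≤ c)
    (h2 : -c ≤ (1 - lam) * ∑ j, deriv (cgf (X j) ((Q j).restrict (G j))) lam)
    (hV : ∑ j, iteratedDeriv 2 (cgf (X j) ((Q j).restrict (G j))) lam ≤ d ^ 2 / 2)
    {A : Set (Fin m → Y)} (hA : MeasurableSet A) :
    ENNReal.ofReal (Real.exp (∑ j, cgf (X j) ((Q j).restrict (G j)) lam - c - d) / 2)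
      ≤ Measure.pi P Aᶜ + Measure.pi Q A := by
  have hNZ : ∀ j, NeZero ((Q j).restrict (G j)) := fun j =>
    ⟨fun h0 => hne j (Measure.restrict_eq_zero.1 h0)⟩
  set ψ : Fin m → ℝ := fun j => cgf (X j) ((Q j).restrict (G j)) lam with hψ
  set R : Fin m → Measure Y := fun j => ((Q j).restrict (G j)).tilted (lam * X j ·) with hR
  have hRp : ∀ j, IsProbabilityMeasure (R j) := fun j =>
    isProbabilityMeasure_tilted ((h j).integrable lam hlam)
  have mX := fun j => (h j).measurable
  have hRd : ∀ j, R j = ((Q j).restrict (G j)).withDensity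
      fun y => ENNReal.ofReal (Real.exp (lam * X j y - ψ j)) := fun j => by
    refine Measure.ext fun s hs => ?_
    rw [withDensity_apply _ hs]
    exact tilted_mul_apply_cgf' hs ((h j).integrable lam hlam)
  -- `u j` and `w j` are the densities of `Q j` and `P j`, restricted to `G j`, with respect to the
  -- tilted law `R j`. Their products depend only on the sum `S` of the log-likelihood ratios.
  set u : Fin m → Y → ℝ≥0∞ := fun j y => ENNReal.ofReal (Real.exp (ψ j - lam * X j y)) with hu
  set w : Fin m → Y → ℝ≥0∞ := fun j y => ENNReal.ofReal (Real.exp (ψ j + (1 - lam) * X j y))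
    with hw
  have mu : ∀ j, Measurable (u j) := fun j => by have := mX j; fun_prop
  have mw : ∀ j, Measurable (w j) := fun j => by have := mX j; fun_prop
  have hQR : ∀ j, (Q j).restrict (G j) = (R j).withDensity (u j) := fun j => by
    rw [hRd j, ← withDensity_mul _ (by have := mX j; fun_prop) (mu j)]
    conv_lhs => rw [← withDensity_one (μ := (Q j).restrict (G j))]
    congr 1
    ext y
    simp only [hu, Pi.mul_apply, Pi.one_apply]
    rw [← ENNReal.ofReal_mul (Real.exp_pos _).le, ← Real.exp_add]
    simp
  have hPR : ∀ j, (P j).restrict (G j) = (R j).withDensity (w j) := fun j => by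
    rw [hRd j, ← withDensity_mul _ (by have := mX j; fun_prop) (mw j), ← (h j).withDensity_eq]
    congr 1
    ext y
    simp only [hw, Pi.mul_apply]
    rw [← ENNReal.ofReal_mul (Real.exp_pos _).le, ← Real.exp_add]
    congr 2
    ring
  have hQm := pi_eq_withDensity _ R u mu hQR
  have hPm := pi_eq_withDensity _ R w mw hPR
  rw [← Measure.restrict_pi_pi] at hQm hPm
  set S : (Fin m → Y) → ℝ := ∑ j, fun y => X j (y j) with hS
  have hSy : ∀ y, S y = ∑ j, X j (y j) := fun y => by simp [hS]
  set D := ∑ j, deriv (cgf (X j) ((Q j).restrict (G j))) lam with hD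
  have mS : Measurable S := by
    have : S = fun y => ∑ j, X j (y j) := funext hSy
    rw [this]
    exact Finset.measurable_sum _ fun j _ => (mX j).comp (measurable_pi_apply j)
  have hL2 : ∀ j, MemLp (X j) 2 (R j) := fun j => memLp_tilted_mul ((h j).mem_interior hlam) 2
  have hL2' : ∀ j, MemLp (fun y : Fin m → Y => X j (y j)) 2 (Measure.pi R) := fun j =>
    (hL2 j).comp_measurePreserving (measurePreserving_eval _ j)
  have hSL2 : MemLp S 2 (Measure.pi R) := memLp_finsetSum' _ fun j _ => hL2' j
  have hmean : (Measure.pi R)[S] = D := by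
    simp only [hSy]
    rw [integral_finsetSum _ fun j _ => (hL2' j).integrable (by norm_num)]
    refine Finset.sum_congr rfl fun j _ => ?_
    rw [← integral_tilted_mul_self ((h j).mem_interior hlam)]
    exact integral_comp_eval (mX j).aestronglyMeasurable
  have hvar : Var[S; Measure.pi R] = ∑ j, iteratedDeriv 2 (cgf (X j) ((Q j).restrict (G j))) lam := by
    rw [hS, variance_sum_pi hL2]
    exact Finset.sum_congr rfl fun j _ => variance_tilted_mul ((h j).mem_interior hlam)
  set E : Set (Fin m → Y) := {y | d ≤ |S y - D|} with hE
  have mE : MeasurableSet E := measurableSet_le measurable_const (mS.sub_const D).abs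
  have hcheb : Measure.pi R E ≤ ENNReal.ofReal (1 / 2) := by
    -- Under the tilted law `S` has mean `D` and its variance is the sum of the second derivatives;
    -- `hV` makes Chebyshev's bound at most one half.
    have h3 := meas_ge_le_variance_div_sq hSL2 hd
    rw [hmean, hvar] at h3
    refine h3.trans (ENNReal.ofReal_le_ofReal ?_)
    rw [div_le_iff₀ (by positivity)]
    linarith
  have hEc : ENNReal.ofReal (1 / 2) ≤ Measure.pi R Eᶜ := by
    rw [prob_compl_eq_one_sub mE]
    calc ENNReal.ofReal (1 / 2) = 1 - ENNReal.ofReal (1 / 2) := by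
          rw [← ENNReal.ofReal_one, ← ENNReal.ofReal_sub _ (by norm_num)]; norm_num
      _ ≤ _ := tsub_le_tsub_left hcheb _
  set κ : ℝ≥0∞ := ENNReal.ofReal (Real.exp (∑ j, ψ j - c - d)) with hκ
  have hSE : ∀ y ∈ Eᶜ, |S y - D| ≤ d := fun y hy => (not_le.1 (fun h => hy h)).le
  have hbu : ∀ y ∈ Eᶜ, κ ≤ ∏ j, u j (y j) := fun y hy => by
    simp only [hu]
    rw [← ENNReal.ofReal_prod_of_nonneg fun j _ => (Real.exp_pos _).le, ← Real.exp_sum]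
    refine ENNReal.ofReal_le_ofReal (Real.exp_le_exp.2 ?_)
    rw [Finset.sum_sub_distrib, ← Finset.mul_sum, ← hSy]
    have h3 := (abs_le.1 (hSE y hy)).2
    have h4 : lam * (S y - D) ≤ d := by
      calc lam * (S y - D) ≤ lam * d := mul_le_mul_of_nonneg_left h3 hlam.1.le
        _ ≤ d := by nlinarith [hlam.2]
    linarith
  -- Replacing `S` by `D` in the exponents costs at most `d`; then `h1` (for `u`) and `h2` (for `w`)
  -- bound the term in `D` by `c`.
  have hbw : ∀ y ∈ Eᶜ, κ ≤ ∏ j, w j (y j) := fun y hy => by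
    simp only [hw]
    rw [← ENNReal.ofReal_prod_of_nonneg fun j _ => (Real.exp_pos _).le, ← Real.exp_sum]
    refine ENNReal.ofReal_le_ofReal (Real.exp_le_exp.2 ?_)
    rw [Finset.sum_add_distrib, ← Finset.mul_sum, ← hSy]
    have h3 := (abs_le.1 (hSE y hy)).1
    have h4 : -d ≤ (1 - lam) * (S y - D) := by
      calc -d ≤ (1 - lam) * (-d) := by nlinarith [hlam.1]
        _ ≤ _ := mul_le_mul_of_nonneg_left h3 (sub_pos.2 hlam.2).le
    linarith
  have hbP : κ * Measure.pi R (Aᶜ ∩ Eᶜ) ≤ Measure.pi P Aᶜ := by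
    refine le_trans ?_ (Measure.restrict_apply_le (s := Set.univ.pi G) (t := Aᶜ))
    rw [hPm, withDensity_apply _ hA.compl, ← setLIntegral_const]
    exact (setLIntegral_mono' (hA.compl.inter mE.compl) fun y hy => hbw y hy.2).trans
      (lintegral_mono_set Set.inter_subset_left)
  have hbQ : κ * Measure.pi R (A ∩ Eᶜ) ≤ Measure.pi Q A := by
    refine le_trans ?_ (Measure.restrict_apply_le (s := Set.univ.pi G) (t := A))
    rw [hQm, withDensity_apply _ hA, ← setLIntegral_const]
    exact (setLIntegral_mono' (hA.inter mE.compl) fun y hy => hbu y hy.2).trans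
      (lintegral_mono_set Set.inter_subset_left)
  calc _ = κ * ENNReal.ofReal (1 / 2) := by
        rw [hκ, ← ENNReal.ofReal_mul (Real.exp_pos _).le]; congr 1; ring
    _ ≤ κ * Measure.pi R Eᶜ := by gcongr
    _ ≤ κ * (Measure.pi R (Aᶜ ∩ Eᶜ) + Measure.pi R (A ∩ Eᶜ)) := by
        gcongr
        refine (measure_mono fun y hy => ?_).trans (measure_union_le _ _)
        by_cases hyA : y ∈ A
        · exact Or.inr ⟨hyA, hy⟩
        · exact Or.inl ⟨hyA, hy⟩
    _ ≤ _ := by rw [mul_add]; exact add_le_add hbP hbQ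

end Converse

/-! ### From a decision rule to a binary test, and the choice of the exponent -/

/-- A decision rule `φ` induces the binary test with acceptance region `φ ⁻¹' {K}`, both of whose
errors are at most the worst-case error of `φ`. -/
lemma half_le_optErrorProb {n k : ℕ} (f₁ f₂ : Measure ℝ) {m : ℕ} (a : Fin m → Fin n → ℝ)
    {K L : Hypothesis n k} (hKL : K ≠ L) (e : ℝ≥0∞)
    (h : ∀ A : Set (Fin m → ℝ), MeasurableSet A → e ≤
      (Measure.pi fun j => obsLaw f₁ f₂ K (a j)) Aᶜ +
      (Measure.pi fun j => obsLaw f₁ f₂ L (a j)) A) :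
    e / 2 ≤ optErrorProb f₁ f₂ k a := by
  refine le_iInf₂ fun φ hφ => ?_
  have h1 := h _ (hφ K)
  set s := ⨆ K : Hypothesis n k, (Measure.pi fun j => obsLaw f₁ f₂ K (a j)) {y | φ y ≠ K} with hs
  have hK : (Measure.pi fun j => obsLaw f₁ f₂ K (a j)) (φ ⁻¹' {K})ᶜ ≤ s :=
    le_iSup (fun K : Hypothesis n k => (Measure.pi fun j => obsLaw f₁ f₂ K (a j)) {y | φ y ≠ K}) K
  have hL : (Measure.pi fun j => obsLaw f₁ f₂ L (a j)) (φ ⁻¹' {K}) ≤ s :=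
    (measure_mono fun y (hy : φ y = K) => show φ y ≠ L from hy ▸ hKL).trans
    (le_iSup (fun K : Hypothesis n k => (Measure.pi fun j => obsLaw f₁ f₂ K (a j)) {y | φ y ≠ K}) L)
  refine ENNReal.div_le_of_le_mul ?_
  rw [mul_two]
  exact h1.trans (add_le_add hK hL)

lemma ofReal_sum_le {ι : Type*} (s : Finset ι) (f : ι → ℝ) :
    ENNReal.ofReal (∑ i ∈ s, f i) ≤ ∑ i ∈ s, ENNReal.ofReal (f i) := by
  classical
  induction s using Finset.induction_on with
  | empty => simp
  | insert a s ha ih =>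
    rw [Finset.sum_insert ha, Finset.sum_insert ha]
    exact ENNReal.ofReal_add_le.trans (by gcongr)

/-- A function on `(0, 1)` that is bounded below is almost stationary somewhere, relative to the
distances to the end points. -/
lemma exists_almost_stationary {ψ : ℝ → ℝ} (hψ : ∀ x ∈ Set.Ioo (0 : ℝ) 1, DifferentiableAt ℝ ψ x)
    {C : ℝ} (hC : ∀ x ∈ Set.Ioo (0 : ℝ) 1, -C ≤ ψ x) {ε : ℝ} (hε : 0 < ε) :
    ∃ x ∈ Set.Ioo (0 : ℝ) 1, x * deriv ψ x ≤ ε ∧ -ε ≤ (1 - x) * deriv ψ x := by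
  -- The logarithmic barrier forces an interior minimum. There `ψ' = ε / x - ε / (1 - x)`, and
  -- multiplying by `x` or by `1 - x` leaves a one-sided bound by `ε`.
  set g : ℝ → ℝ := fun x => ψ x - ε * Real.log x - ε * Real.log (1 - x) with hg
  set M := g (1 / 2) with hM
  -- Within `η` of an end point the barrier is at least `M + C`, so `g` is at least its value at `1
  -- / 2`; the bound `1 / 4` keeps `1 / 2` in the compact interval.
  set η := min (1 / 4) (Real.exp (-((M + C) / ε))) with hη
  have η0 : 0 < η := lt_min (by norm_num) (Real.exp_pos _)
  have η1 : η ≤ 1 / 4 := min_le_left _ _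
  have hsmall : ∀ x, 0 < x → x ≤ η → M + C ≤ -(ε * Real.log x) := fun x hx hxη => by
    have h1 : Real.log x ≤ -((M + C) / ε) := by
      rw [← Real.log_exp (-((M + C) / ε))]
      exact Real.log_le_log hx (hxη.trans (min_le_right _ _))
    have h2 : ε * Real.log x ≤ ε * -((M + C) / ε) := mul_le_mul_of_nonneg_left h1 hε.le
    have h3 : ε * -((M + C) / ε) = -(M + C) := by field_simp
    linarith
  have hlogn : ∀ x ∈ Set.Ioo (0 : ℝ) 1, ε * Real.log x ≤ 0 := fun x hx =>
    mul_nonpos_of_nonneg_of_nonpos hε.le (Real.log_nonpos hx.1.le hx.2.le)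
  have hsub : Set.Icc η (1 - η) ⊆ Set.Ioo (0 : ℝ) 1 := fun x hx =>
    ⟨η0.trans_le hx.1, hx.2.trans_lt (by linarith)⟩
  have hder : ∀ x ∈ Set.Ioo (0 : ℝ) 1,
      HasDerivAt g (deriv ψ x - ε * x⁻¹ - ε * (-1 / (1 - x))) x := fun x hx =>
    ((hψ x hx).hasDerivAt.sub ((Real.hasDerivAt_log hx.1.ne').const_mul ε)).sub
      ((((hasDerivAt_id x).const_sub 1).log (sub_pos.2 hx.2).ne').const_mul ε)
  obtain ⟨x, hx, hmin⟩ := isCompact_Icc.exists_isMinOn (s := Set.Icc η (1 - η)) (f := g)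
    ⟨1 / 2, by constructor <;> linarith⟩
    fun x hx => (hder x (hsub hx)).continuousAt.continuousWithinAt
  have hxI := hsub hx
  have hxM : g x ≤ M := hmin (show (1 / 2 : ℝ) ∈ Set.Icc η (1 - η) by constructor <;> linarith)
  have hglob : ∀ y ∈ Set.Ioo (0 : ℝ) 1, g x ≤ g y := fun y hy => by
    have hy' : 1 - y ∈ Set.Ioo (0 : ℝ) 1 := ⟨sub_pos.2 hy.2, by linarith [hy.1]⟩
    have e1 := hC y hy
    have e2 := hlogn y hy
    have e3 := hlogn _ hy'
    by_cases h1 : y < η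
    · have := hsmall y hy.1 h1.le
      simp only [hg] at hxM ⊢
      linarith
    by_cases h2 : 1 - η < y
    · have := hsmall (1 - y) hy'.1 (by linarith)
      simp only [hg] at hxM ⊢
      linarith
    exact hmin ⟨not_lt.1 h1, not_lt.1 h2⟩
  have hloc : IsLocalMin g x := by
    filter_upwards [isOpen_Ioo.mem_nhds hxI] with y hy using hglob y hy
  have hzero := hloc.hasDerivAt_eq_zero (hder x hxI)
  have h1x : 0 < 1 - x := sub_pos.2 hxI.2
  have hd : deriv ψ x = ε * x⁻¹ - ε * (1 / (1 - x)) := by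
    have : -1 / (1 - x) = -(1 / (1 - x)) := by ring
    rw [this] at hzero
    linarith
  refine ⟨x, hxI, ?_, ?_⟩
  · have : x * deriv ψ x = ε - ε * (x / (1 - x)) := by
      rw [hd]; field_simp [hxI.1.ne']
    rw [this]
    have : 0 ≤ ε * (x / (1 - x)) := mul_nonneg hε.le (div_nonneg hxI.1.le h1x.le)
    linarith
  · have : (1 - x) * deriv ψ x = ε * ((1 - x) / x) - ε := by
      have hx0 := hxI.1.ne'
      rw [hd]; field_simp
    rw [this]
    have : 0 ≤ ε * ((1 - x) / x) := mul_nonneg hε.le (div_nonneg h1x.le hxI.1.le)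
    linarith

/-! ### Finitely supported distributions and their schemes -/

/-- The set in `IsFiniteDistribution` may contain null points; discarding them leaves exactly the
atoms. -/
lemma IsFiniteDistribution.exists_atoms {n : ℕ} {p : Measure (Fin n → ℝ)}
    (hp : IsFiniteDistribution p) : ∃ S : Finset (Fin n → ℝ), (∀ b, b ∈ S ↔ p {b} ≠ 0) ∧
      (∀ F : (Fin n → ℝ) → ℝ≥0∞, ∫⁻ a, F a ∂p = ∑ b ∈ S, p {b} * F b) ∧
      ∑ b ∈ S, p.real {b} = 1 := by
  classical
  obtain ⟨hprob, s, hs⟩ := hp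
  have hF : ∀ F : (Fin n → ℝ) → ℝ≥0∞, ∫⁻ a, F a ∂p = ∑ b ∈ s with p {b} ≠ 0, p {b} * F b := by
    intro F
    have h1 : p.restrict (s : Set (Fin n → ℝ)) = p := by
      rw [Measure.restrict_eq_self_of_ae_mem]
      exact mem_ae_iff.2 hs
    conv_lhs => rw [← h1]
    rw [lintegral_finset, Finset.sum_filter_of_ne]
    · exact Finset.sum_congr rfl fun b _ => mul_comm _ _
    · intro b _ hb h0
      simp [h0] at hb
  refine ⟨{b ∈ s | p {b} ≠ 0}, fun b => ?_, hF, ?_⟩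
  · simp only [Finset.mem_filter, and_iff_right_iff_imp]
    intro hb
    by_contra hbs
    exact hb (measure_mono_null (by simpa using hbs) hs)
  · have h1 := hF 1
    simp only [Pi.one_apply, lintegral_one, measure_univ, mul_one] at h1
    have := congrArg ENNReal.toReal h1
    rw [ENNReal.toReal_sum fun b _ => measure_ne_top _ _] at this
    simpa [Measure.real] using this.symm

lemma sum_scheme {n m : ℕ} {S : Finset (Fin n → ℝ)} {a : Fin m → Fin n → ℝ} (ha : ∀ j, a j ∈ S)
    {M : Type*} [AddCommMonoid M] (F : (Fin n → ℝ) → M) :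
    ∑ j, F (a j) = ∑ b ∈ S, Nat.card {j : Fin m // a j = b} • F b := by
  classical
  rw [← Finset.sum_fiberwise_of_maps_to (s := Finset.univ) (t := S) (g := a) (fun j _ => ha j)]
  refine Finset.sum_congr rfl fun b _ => ?_
  rw [Finset.sum_congr rfl (g := fun _ => F b) (by simp +contextual), Finset.sum_const,
    Nat.card_eq_fintype_card, Fintype.card_subtype]

lemma exists_isSchemeFor {n : ℕ} {p : Measure (Fin n → ℝ)} (hp : IsFiniteDistribution p) :
    ∃ a, IsSchemeFor p a := by
  classical
  obtain ⟨S, hS, -, hsum⟩ := hp.exists_atoms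
  have hprob := hp.1
  have hne : S.Nonempty := by
    rw [Finset.nonempty_iff_ne_empty]
    rintro rfl
    simp at hsum
  obtain ⟨b₀, hb₀⟩ := hne
  -- Each atom other than `b₀` is used `⌊p {b} * m⌋` times; `b₀` absorbs the remainder, whose
  -- fraction converges to `p {b₀}` because the others do.
  set f : ℕ → (Fin n → ℝ) → ℕ := fun m b => ⌊p.real {b} * (m : ℝ)⌋₊ with hf
  set r : ℕ → ℕ := fun m => ∑ b ∈ S.erase b₀, f m b with hr
  have hsum' : ∑ b ∈ S.erase b₀, p.real {b} = 1 - p.real {b₀} := by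
    rw [← hsum, ← Finset.add_sum_erase _ _ hb₀]; ring
  have hrm : ∀ m, r m ≤ m := fun m => by
    have h1 : (r m : ℝ) ≤ m := by
      rw [hr, Nat.cast_sum]
      calc ∑ b ∈ S.erase b₀, (f m b : ℝ) ≤ ∑ b ∈ S.erase b₀, p.real {b} * m :=
            Finset.sum_le_sum fun b _ => Nat.floor_le (by positivity)
        _ = (1 - p.real {b₀}) * m := by rw [← Finset.sum_mul, hsum']
        _ ≤ m := by
          have : 0 ≤ p.real {b₀} * (m : ℝ) := by positivity
          linarith
    exact_mod_cast h1
  set c : ℕ → (Fin n → ℝ) → ℕ := fun m b => if b = b₀ then m - r m else f m b with hc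
  have hcsum : ∀ m, ∑ b : S, c m b = m := fun m => by
    rw [Finset.sum_coe_sort S (c m), ← Finset.add_sum_erase _ _ hb₀]
    have : ∑ b ∈ S.erase b₀, c m b = r m :=
      Finset.sum_congr rfl fun b hb => if_neg (Finset.ne_of_mem_erase hb)
    rw [this]
    simp [hc, hrm m]
  have hcard : ∀ m, Fintype.card (Σ b : S, Fin (c m b)) = m := fun m => by
    rw [Fintype.card_sigma]
    simpa only [Fintype.card_fin] using hcsum m
  set e : ∀ m, Fin m ≃ Σ b : S, Fin (c m b) := fun m =>
    (Fintype.equivFinOfCardEq (hcard m)).symm with he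
  refine ⟨fun m j => ((e m j).1 : Fin n → ℝ), fun m j => (hS _).1 (e m j).1.2, fun b => ?_⟩
  have hcount : ∀ m, ∀ b ∈ S, Nat.card {j : Fin m // ((e m j).1 : Fin n → ℝ) = b} = c m b := by
    intro m b hb
    have e1 : {j : Fin m // ((e m j).1 : Fin n → ℝ) = b} ≃
        {x : Σ b : S, Fin (c m b) // x.1 = ⟨b, hb⟩} :=
      (e m).subtypeEquiv fun j => by rw [Subtype.ext_iff]
    rw [Nat.card_congr (e1.trans (Equiv.sigmaSubtype (β := fun b : S => Fin (c m b)) ⟨b, hb⟩)), Nat.card_fin]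
  have hlim : ∀ b, Tendsto (fun m : ℕ => (f m b : ℝ) / m) atTop (𝓝 (p.real {b})) := fun b =>
    (tendsto_nat_floor_mul_div_atTop (R := ℝ) (a := p.real {b}) measureReal_nonneg).comp
      tendsto_natCast_atTop_atTop
  by_cases hbS : b ∈ S
  · simp only [hcount _ b hbS]
    by_cases hbb : b = b₀
    · subst hbb
      have h1 : Tendsto (fun m : ℕ => (1 : ℝ) - ∑ b' ∈ S.erase b, (f m b' : ℝ) / m) atTop
          (𝓝 (1 - ∑ b' ∈ S.erase b, p.real {b'})) :=
        tendsto_const_nhds.sub (tendsto_finsetSum _ fun b' _ => hlim b')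
      rw [hsum', sub_sub_cancel] at h1
      refine h1.congr' ?_
      filter_upwards [eventually_gt_atTop 0] with m hm
      have hm' : (m : ℝ) ≠ 0 := by exact_mod_cast hm.ne'
      simp only [hc, if_true]
      rw [Nat.cast_sub (hrm m), sub_div, div_self hm', ← Finset.sum_div, hr, Nat.cast_sum]
    · simp only [hc, if_neg hbb]
      exact hlim b
  · have h0 : p.real {b} = 0 := by
      have : p {b} = 0 := by simpa using (hS b).not.1 hbS
      simp [Measure.real, this]
    rw [h0]
    have : ∀ m, Nat.card {j : Fin m // ((e m j).1 : Fin n → ℝ) = b} = 0 := fun m => by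
      have : IsEmpty {j : Fin m // ((e m j).1 : Fin n → ℝ) = b} :=
        ⟨fun j => hbS (j.2 ▸ (e m j.1).1.2)⟩
      exact Nat.card_of_isEmpty
    simp only [this, Nat.cast_zero, zero_div, tendsto_const_nhds]

/-! ### The error exponent -/

section Asymptotics

variable {n k : ℕ} {f₁ f₂ : Measure ℝ} [IsProbabilityMeasure f₁] [IsProbabilityMeasure f₂]
  {p : Measure (Fin n → ℝ)} {a : (m : ℕ) → Fin m → Fin n → ℝ}

lemma IsSchemeFor.eventually_lt_negLog (hk : k ≤ n) (hp : IsFiniteDistribution p)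
    (ha : IsSchemeFor p a) {t : ℝ≥0∞} (ht : t < minOuterChernoff f₁ f₂ k p) :
    ∀ᶠ m : ℕ in atTop, t < negLog (optErrorProb f₁ f₂ k (a m)) / m := by
  obtain ⟨S, hS, hint, -⟩ := hp.exists_atoms
  have hprob := hp.1
  -- The gap between `t` and `T` absorbs the loss `log B / m` from combining the pairwise tests.
  -- With only one hypothesis there are no pairs, and `T` can be any real above `t`.
  obtain ⟨T', htT, hT⟩ := ENNReal.lt_iff_exists_nnreal_btwn.1 ht
  obtain ⟨T, hTdef⟩ : ∃ T : ℝ, T = (T' : ℝ) := ⟨_, rfl⟩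
  have hT'' : (T' : ℝ≥0∞) = ENNReal.ofReal T := by rw [hTdef, ENNReal.ofReal_coe_nnreal]
  rw [hT''] at htT hT
  have hT0 : 0 < T := ENNReal.ofReal_pos.1 (bot_le.trans_lt htT)
  have hmem : ∀ m j, a m j ∈ S := fun m j => (hS _).2 (ha.1 m j)
  have hfrac : ∀ b, Tendsto (fun m : ℕ => (Nat.card {j : Fin m // a m j = b} : ℝ≥0∞) / m) atTop
      (𝓝 (p {b})) := fun b => by
    have h1 := ENNReal.tendsto_ofReal (ha.2 b)
    rw [ofReal_measureReal] at h1
    refine h1.congr' ?_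
    filter_upwards [eventually_gt_atTop 0] with m hm
    rw [ENNReal.ofReal_div_of_pos (by exact_mod_cast hm)]
    simp
  have hpair : ∀ K L : Hypothesis n k, K ≠ L → ∀ᶠ m : ℕ in atTop,
      ∃ A : Set (Fin m → ℝ), MeasurableSet A ∧
      (Measure.pi fun j => obsLaw f₁ f₂ K (a m j)) Aᶜ ≤ ENNReal.ofReal (Real.exp (-(T * m))) ∧
      (Measure.pi fun j => obsLaw f₁ f₂ L (a m j)) A ≤ ENNReal.ofReal (Real.exp (-(T * m))) := by
    intro K L hKL
    have h1 : ENNReal.ofReal T < outerChernoff f₁ f₂ p K L :=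
      hT.trans_le ((iInf_le _ K).trans ((iInf_le _ L).trans (iInf_le _ hKL)))
    simp only [outerChernoff, lt_iSup_iff] at h1
    obtain ⟨lam, hlam, h1⟩ := h1
    rw [hint] at h1
    set N : (Fin n → ℝ) → ℝ≥0∞ := fun b =>
      negLog (affinity lam (obsLaw f₁ f₂ K b) (obsLaw f₁ f₂ L b)) with hN
    -- `N b` may be infinite; the limit still passes through the product because `p {b} ≠ 0` on `S`.
    have h2 : Tendsto (fun m : ℕ => ∑ b ∈ S, (Nat.card {j : Fin m // a m j = b} : ℝ≥0∞) / m * N b)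
        atTop (𝓝 (∑ b ∈ S, p {b} * N b)) :=
      tendsto_finsetSum _ fun b hb => ENNReal.Tendsto.mul_const (hfrac b) (Or.inl ((hS b).1 hb))
    filter_upwards [h2.eventually (lt_mem_nhds h1), eventually_gt_atTop 0] with m hm hm0
    obtain ⟨A, mA, hA⟩ := exists_test (fun j => obsLaw f₁ f₂ K (a m j))
      (fun j => obsLaw f₁ f₂ L (a m j))
    have h3 : ∏ j, affinity lam (obsLaw f₁ f₂ K (a m j)) (obsLaw f₁ f₂ L (a m j))
        ≤ ENNReal.ofReal (Real.exp (-(T * m))) := by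
      have hm0' : (0 : ℝ) < m := by exact_mod_cast hm0
      refine le_ofReal_exp_of_le_negLog (by positivity) ?_
      rw [negLog_prod _ fun j _ => affinity_le_one hlam _ _, sum_scheme (hmem m) N,
        ENNReal.ofReal_mul hT0.le, ENNReal.ofReal_natCast]
      calc ENNReal.ofReal T * m
          ≤ (∑ b ∈ S, (Nat.card {j : Fin m // a m j = b} : ℝ≥0∞) / m * N b) * m := by gcongr
        _ = _ := by
          rw [Finset.sum_mul]
          refine Finset.sum_congr rfl fun b _ => ?_
          rw [nsmul_eq_mul, mul_right_comm, ENNReal.div_mul_cancel (by exact_mod_cast hm0.ne')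
            (ENNReal.natCast_ne_top m)]
    exact ⟨A, mA, (hA lam hlam).1.trans h3, (hA lam hlam).2.trans h3⟩
  have hall := eventually_all.2 fun K => eventually_all.2 fun L => eventually_imp_distrib_left.2 (hpair K L)
  set B : ℝ := Fintype.card (Hypothesis n k) * 2 with hB
  have hBpos : 0 < B := by
    have := nonempty_hypothesis hk
    have : 0 < Fintype.card (Hypothesis n k) := Fintype.card_pos
    positivity
  have hlim : Tendsto (fun m : ℕ => ENNReal.ofReal (T - Real.log B / m)) atTop
      (𝓝 (ENNReal.ofReal T)) := by
    refine ENNReal.tendsto_ofReal ?_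
    simpa using tendsto_const_nhds.sub (tendsto_const_div_atTop_nhds_zero_nat (Real.log B))
  filter_upwards [hall, hlim.eventually (lt_mem_nhds htT), eventually_gt_atTop 0] with m hm hm1 hm0
  have hm0' : (0 : ℝ) < m := by exact_mod_cast hm0
  refine hm1.trans_le ?_
  have h1 := optErrorProb_le hk f₁ f₂ (a m) _ hm
  have h2 : (Fintype.card (Hypothesis n k) : ℝ≥0∞) * (2 * ENNReal.ofReal (Real.exp (-(T * m))))
      = ENNReal.ofReal (B * Real.exp (-(T * m))) := by
    rw [ENNReal.ofReal_mul hBpos.le, hB, ENNReal.ofReal_mul (by positivity)]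
    simp [mul_assoc]
  rw [h2] at h1
  have h3 := negLog_antitone h1
  rw [negLog_ofReal (by positivity), Real.log_mul hBpos.ne' (Real.exp_pos _).ne', Real.log_exp] at h3
  rw [ENNReal.le_div_iff_mul_le (Or.inl (by exact_mod_cast hm0.ne'))
    (Or.inl (ENNReal.natCast_ne_top m)), ← ENNReal.ofReal_natCast, ← ENNReal.ofReal_mul' hm0'.le]
  refine le_trans (ENNReal.ofReal_le_ofReal (le_of_eq ?_)) h3
  field_simp
  ring

lemma IsSchemeFor.eventually_negLog_lt (hp : IsFiniteDistribution p)
    (ha : IsSchemeFor p a) {K L : Hypothesis n k} (hKL : K ≠ L) {t : ℝ≥0∞}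
    (ht : outerChernoff f₁ f₂ p K L < t) :
    ∀ᶠ m : ℕ in atTop, negLog (optErrorProb f₁ f₂ k (a m)) / m < t := by
  obtain ⟨S, hS, hint, -⟩ := hp.exists_atoms
  have hprob := hp.1
  obtain ⟨T, hCT, hTt⟩ := ENNReal.lt_iff_exists_nnreal_btwn.1 ht
  set C : ℝ := (outerChernoff f₁ f₂ p K L).toReal with hC
  have hfin : outerChernoff f₁ f₂ p K L ≠ ⊤ := (hCT.trans ENNReal.coe_lt_top).ne
  have hCT' : C < T := by
    have := ENNReal.toReal_strict_mono ENNReal.coe_ne_top hCT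
    simpa using this
  have hmem : ∀ m j, a m j ∈ S := fun m j => (hS _).2 (ha.1 m j)
  choose G X hGX using fun b : Fin n → ℝ =>
    exists_isLogLikelihoodRatio (obsLaw f₁ f₂ K b) (obsLaw f₁ f₂ L b)
  have hle : ∀ lam ∈ Set.Ioo (0 : ℝ) 1,
      ∑ b ∈ S, p {b} * negLog (affinity lam (obsLaw f₁ f₂ K b) (obsLaw f₁ f₂ L b))
        ≤ outerChernoff f₁ f₂ p K L := fun lam hlam => by
    rw [← hint]
    exact le_iSup₂_of_le (f := fun lam (_ : lam ∈ Set.Icc (0 : ℝ) 1) =>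
      ∫⁻ a, negLog (affinity lam (obsLaw f₁ f₂ K a) (obsLaw f₁ f₂ L a)) ∂p) lam
      ⟨hlam.1.le, hlam.2.le⟩ le_rfl
  -- If the two laws were mutually singular for some atom, the affinity there would be `0` and the
  -- outer Chernoff information infinite.
  have hne : ∀ b ∈ S, obsLaw f₁ f₂ L b (G b) ≠ 0 := fun b hb h0 => by
    have hh : (1 / 2 : ℝ) ∈ Set.Ioo (0 : ℝ) 1 := by norm_num
    refine hfin (top_le_iff.1 (le_trans (top_le_iff.2 ?_) (hle _ hh)))
    refine ENNReal.sum_eq_top.2 ⟨b, hb, ?_⟩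
    rw [(hGX b).affinity_eq _ hh, Measure.restrict_eq_zero.2 h0, mgf_zero_measure]
    simp [ENNReal.mul_top ((hS b).1 hb)]
  set μ : (Fin n → ℝ) → Measure ℝ := fun b => (obsLaw f₁ f₂ L b).restrict (G b) with hμ
  set ψ : (Fin n → ℝ) → ℝ → ℝ := fun b => cgf (X b) (μ b) with hψ
  set Ψ : ℝ → ℝ := fun x => ∑ b ∈ S, p.real {b} * ψ b x with hΨ
  have hdiff : ∀ x ∈ Set.Ioo (0 : ℝ) 1, ∀ b, DifferentiableAt ℝ (ψ b) x := fun x hx b =>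
    (analyticAt_cgf ((hGX b).mem_interior hx)).differentiableAt
  have hΨd : ∀ x ∈ Set.Ioo (0 : ℝ) 1,
      HasDerivAt Ψ (∑ b ∈ S, p.real {b} * deriv (ψ b) x) x := fun x hx =>
    HasDerivAt.fun_sum fun b _ => ((hdiff x hx b).hasDerivAt.const_mul _)
  have hlow : ∀ x ∈ Set.Ioo (0 : ℝ) 1, -C ≤ Ψ x := fun x hx => by
    have h1 : ENNReal.ofReal (∑ b ∈ S, p.real {b} * -ψ b x) ≤ ENNReal.ofReal C := by
      rw [hC, ENNReal.ofReal_toReal hfin]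
      refine le_trans ((ofReal_sum_le _ _).trans (Finset.sum_le_sum fun b hb => ?_)) (hle x hx)
      have hpos : 0 < mgf (X b) (μ b) x :=
        mgf_pos' (fun h0 => hne b hb (Measure.restrict_eq_zero.1 h0)) ((hGX b).integrable x hx)
      rw [(hGX b).affinity_eq _ hx, negLog_ofReal hpos, ENNReal.ofReal_mul measureReal_nonneg,
        ofReal_measureReal]
      rfl
    have h2 := (ENNReal.ofReal_le_ofReal_iff ENNReal.toReal_nonneg).1 h1
    have h3 : ∑ b ∈ S, p.real {b} * -ψ b x = -Ψ x := by simp [hΨ]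
    linarith
  -- The five shares: one for the averaged `ψ`, two for `c`, one for `d`, and one for `log 4 / m`.
  set ε : ℝ := (T - C) / 5 with hε
  have hε0 : 0 < ε := by rw [hε]; linarith
  obtain ⟨x, hx, hx1, hx2⟩ := exists_almost_stationary (fun x hx => (hΨd x hx).differentiableAt)
    hlow hε0
  rw [(hΨd x hx).deriv] at hx1 hx2
  have hlim : ∀ F : (Fin n → ℝ) → ℝ, Tendsto (fun m : ℕ => (∑ j, F (a m j)) / m) atTop
      (𝓝 (∑ b ∈ S, p.real {b} * F b)) := fun F => by
    have h1 : ∀ m : ℕ, (∑ j, F (a m j)) / m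
        = ∑ b ∈ S, (Nat.card {j : Fin m // a m j = b} : ℝ) / m * F b := fun m => by
      rw [sum_scheme (hmem m) F, Finset.sum_div]
      refine Finset.sum_congr rfl fun b _ => ?_
      rw [nsmul_eq_mul]; ring
    simp only [h1]
    exact tendsto_finsetSum _ fun b _ => (ha.2 b).mul_const _
  have l1 := ((hlim fun b => deriv (ψ b) x).const_mul x).eventually_le_const
    (show _ < 2 * ε by linarith)
  have l2 := ((hlim fun b => deriv (ψ b) x).const_mul (1 - x)).eventually_const_le
    (show -(2 * ε) < _ by linarith)
  have l3 := (hlim fun b => ψ b x).eventually_const_le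
    (show -C - ε < _ by have := hlow x hx; simp only [hΨ] at this; linarith)
  -- The variance grows linearly in `m`, while `d ^ 2 / 2` with `d = ε * m` grows quadratically.
  have l4 : ∀ᶠ m : ℕ in atTop, (∑ j, iteratedDeriv 2 (ψ (a m j)) x) / m ≤ ε ^ 2 / 2 * m := by
    have h1 := (hlim fun b => iteratedDeriv 2 (ψ b) x).eventually_le_const (lt_add_one _)
    have h2 : Tendsto (fun m : ℕ => ε ^ 2 / 2 * (m : ℝ)) atTop atTop :=
      tendsto_natCast_atTop_atTop.const_mul_atTop (by positivity)
    filter_upwards [h1, h2.eventually_ge_atTop _] with m g1 g2 using g1.trans g2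
  have l5 : ∀ᶠ m : ℕ in atTop, Real.log 4 / m ≤ ε :=
    (tendsto_const_div_atTop_nhds_zero_nat (Real.log 4)).eventually_le_const hε0
  filter_upwards [l1, l2, l3, l4, l5, eventually_gt_atTop 0] with m g1 g2 g3 g4 g5 hm0
  have hm0' : (0 : ℝ) < m := by exact_mod_cast hm0
  refine lt_of_le_of_lt ?_ hTt
  have g2' : -(2 * ε * m) ≤ (1 - x) * ∑ j, deriv (ψ (a m j)) x := by
    have := (le_div_iff₀ hm0').1 (g2.trans_eq (mul_div_assoc _ _ _).symm)
    linarith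
  have key := half_le_optErrorProb f₁ f₂ (a m) hKL _ fun A hA =>
    two_point_lower_bound (fun j => obsLaw f₁ f₂ K (a m j)) (fun j => obsLaw f₁ f₂ L (a m j))
      (fun j => G (a m j)) (fun j => X (a m j)) (fun j => hGX (a m j))
      (fun j => hne _ (hmem m j)) hx (c := 2 * ε * m) (d := ε * m) (by positivity)
      (by rwa [← mul_div_assoc, div_le_iff₀ hm0'] at g1)
      g2'
      (by rw [div_le_iff₀ hm0'] at g4; exact g4.trans (le_of_eq (by ring))) hA
  have h1 : ENNReal.ofReal (Real.exp (-(C + 4 * ε) * m) / 4) ≤ optErrorProb f₁ f₂ k (a m) := by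
    refine le_trans ?_ key
    have : (2 : ℝ≥0∞) = ENNReal.ofReal 2 := by simp
    rw [this, ← ENNReal.ofReal_div_of_pos (by norm_num), div_div]
    norm_num only
    refine ENNReal.ofReal_le_ofReal (div_le_div_of_nonneg_right (Real.exp_le_exp.2 ?_) (by norm_num))
    rw [le_div_iff₀ hm0'] at g3
    linarith
  have h2 := negLog_antitone h1
  rw [negLog_ofReal (by positivity), Real.log_div (Real.exp_pos _).ne' (by norm_num),
    Real.log_exp] at h2
  refine ENNReal.div_le_of_le_mul (h2.trans ?_)
  rw [← ENNReal.ofReal_coe_nnreal, ← ENNReal.ofReal_natCast, ← ENNReal.ofReal_mul T.coe_nonneg]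
  refine ENNReal.ofReal_le_ofReal ?_
  rw [div_le_iff₀ hm0'] at g5
  have : (T : ℝ) = C + 5 * ε := by rw [hε]; ring
  rw [this]
  linarith

theorem hasErrorExponent_minOuterChernoff (hk : k ≤ n) (hp : IsFiniteDistribution p) :
    HasErrorExponent f₁ f₂ k p (minOuterChernoff f₁ f₂ k p) := by
  refine ⟨exists_isSchemeFor hp, fun a ha => tendsto_order.2 ⟨fun t ht =>
    ha.eventually_lt_negLog hk hp ht, fun t ht => ?_⟩⟩
  simp only [minOuterChernoff, iInf_lt_iff] at ht
  obtain ⟨K, L, hKL, ht⟩ := ht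
  exact ha.eventually_negLog_lt hp hKL ht

end Asymptotics

/-! ### Passing from finitely supported to Borel distributions -/

/-- Finitely many lower integrals can be bounded below by those of a single finitely supported
probability measure; no measurability is needed. -/
lemma exists_finite_lt_lintegral {α ι : Type*} [MeasurableSpace α] [MeasurableSingletonClass α]
    [Finite ι] (q : Measure α) [IsProbabilityMeasure q] (F : ι → α → ℝ≥0∞) (t : ι → ℝ≥0∞)
    (h : ∀ i, t i < ∫⁻ a, F i a ∂q) :
    ∃ p : Measure α, IsProbabilityMeasure p ∧ (∃ s : Finset α, p (s : Set α)ᶜ = 0) ∧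
      ∀ i, t i < ∫⁻ a, F i a ∂p := by
  classical
  have := Fintype.ofFinite ι
  have hg : ∀ i, ∃ g : SimpleFunc α ℝ≥0∞, ⇑g ≤ F i ∧ t i < g.lintegral q := fun i => by
    have := h i
    simp only [lintegral, lt_iSup_iff] at this
    obtain ⟨g, hg, hlt⟩ := this
    exact ⟨g, hg, hlt⟩
  choose g hgF hgt using hg
  -- The level sets of this joint simple function refine those of all `g i`, so one sample point per
  -- level set serves every `i`.
  have hG : ∃ G : SimpleFunc α (ι → ℝ≥0∞), ∀ x i, G x i = g i x := by
    refine ⟨⟨fun x i => g i x, fun v => ?_, ?_⟩, fun x i => rfl⟩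
    · have : (fun x i => g i x) ⁻¹' {v} = ⋂ i, g i ⁻¹' {v i} := by
        ext x; simp [funext_iff]
      rw [this]
      exact MeasurableSet.iInter fun i => (g i).measurableSet_fiber _
    · refine (Set.Finite.pi' fun i => (g i).finite_range).subset ?_
      rintro _ ⟨x, rfl⟩ i
      exact ⟨x, rfl⟩
  obtain ⟨G, hG⟩ := hG
  have hpt : ∀ v ∈ G.range, ∃ x, G x = v := fun v hv => by simpa using hv
  have hne : Nonempty α := by
    by_contra hemp
    rw [not_nonempty_iff] at hemp
    have := measure_univ (μ := q)
    rw [Set.univ_eq_empty_iff.2 hemp, measure_empty] at this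
    exact zero_ne_one this
  choose! x hx using hpt
  -- Every `g i` has the same integral against `p` as against `q`, and `F i` dominates `g i` at the
  -- sample points.
  set p : Measure α := ∑ v ∈ G.range, q (G ⁻¹' {v}) • Measure.dirac (x v) with hp
  have hpint : ∀ H : α → ℝ≥0∞, ∫⁻ a, H a ∂p = ∑ v ∈ G.range, q (G ⁻¹' {v}) * H (x v) := by
    intro H
    rw [hp, lintegral_finsetSum_measure]
    simp
  refine ⟨p, ⟨?_⟩, ⟨G.range.image x, ?_⟩, fun i => ?_⟩
  · have h1 := hpint 1
    simp only [Pi.one_apply, lintegral_one, mul_one] at h1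
    rw [h1, G.sum_range_measure_preimage_singleton, measure_univ]
  · rw [hp, Measure.finsetSum_apply]
    refine Finset.sum_eq_zero fun v hv => ?_
    have : x v ∈ G.range.image x := Finset.mem_image_of_mem x hv
    rw [Measure.smul_apply, Measure.dirac_apply]
    simp [Set.indicator, -Finset.coe_image, this]
  · refine (hgt i).trans_le ?_
    have h1 : (g i).lintegral q = ∑ v ∈ G.range, q (G ⁻¹' {v}) * v i := by
      have h2 : g i = G.map fun v => v i := by ext y; exact (hG y i).symm
      rw [h2, SimpleFunc.map_lintegral]
      exact Finset.sum_congr rfl fun v _ => mul_comm _ _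
    rw [h1, hpint]
    refine Finset.sum_le_sum fun v hv => ?_
    gcongr
    calc v i = g i (x v) := by rw [← hG, hx v hv]
      _ ≤ F i (x v) := hgF i _

/-- Being a supremum over `lam`, the outer Chernoff information under `p` is bounded below through
the exponents selected under `q`, one for each of the finitely many pairs. -/
lemma exists_isFiniteDistribution_lt {n k : ℕ} (f₁ f₂ : Measure ℝ) (q : Measure (Fin n → ℝ))
    [IsProbabilityMeasure q] {t : ℝ≥0∞} (ht : t < minOuterChernoff f₁ f₂ k q) :
    ∃ p : Measure (Fin n → ℝ), IsFiniteDistribution p ∧ t ≤ minOuterChernoff f₁ f₂ k p := by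
  have h1 : ∀ i : {KL : Hypothesis n k × Hypothesis n k // KL.1 ≠ KL.2},
      ∃ lam ∈ Set.Icc (0 : ℝ) 1,
        t < ∫⁻ a, negLog (affinity lam (obsLaw f₁ f₂ i.1.1 a) (obsLaw f₁ f₂ i.1.2 a)) ∂q := by
    rintro ⟨⟨K, L⟩, hKL⟩
    have h2 : t < outerChernoff f₁ f₂ q K L :=
      ht.trans_le ((iInf_le _ K).trans ((iInf_le _ L).trans (iInf_le _ hKL)))
    simp only [outerChernoff, lt_iSup_iff] at h2
    obtain ⟨lam, hlam, h2⟩ := h2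
    exact ⟨lam, hlam, h2⟩
  choose lam hlam h1 using h1
  obtain ⟨p, hp, hs, hlt⟩ := exists_finite_lt_lintegral q _ _ h1
  refine ⟨p, ⟨hp, hs⟩, le_iInf fun K => le_iInf fun L => le_iInf fun hKL => ?_⟩
  exact (hlt ⟨(K, L), hKL⟩).le.trans (le_iSup₂_of_le (f := fun lam (_ : lam ∈ Set.Icc (0 : ℝ) 1) =>
      ∫⁻ a, negLog (affinity lam (obsLaw f₁ f₂ K a) (obsLaw f₁ f₂ L a)) ∂p) _
      (hlam ⟨(K, L), hKL⟩) le_rfl)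

lemma HasErrorExponent.unique {n k : ℕ} {f₁ f₂ : Measure ℝ} {p : Measure (Fin n → ℝ)}
    {E E' : ℝ≥0∞} (h : HasErrorExponent f₁ f₂ k p E) (h' : HasErrorExponent f₁ f₂ k p E') :
    E = E' := by
  obtain ⟨a, ha⟩ := h.1
  exact tendsto_nhds_unique (h.2 a ha) (h'.2 a ha)

/-- The left side compares only with finitely supported measures. A Borel measure beating `p` would
be approximated by a finitely supported one that still beats it. -/
theorem maximizesErrorExponent_iff {n k : ℕ} {f₁ f₂ : Measure ℝ} [IsProbabilityMeasure f₁]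
    [IsProbabilityMeasure f₂] (hk : k ≤ n) {p : Measure (Fin n → ℝ)} (hp : IsFiniteDistribution p) :
    MaximizesErrorExponent f₁ f₂ k p ↔ MaximizesMinOuterChernoff f₁ f₂ k p := by
  constructor
  · rintro ⟨-, E, hE, hmax⟩
    refine ⟨hp.1, fun q hq => le_of_forall_lt fun t ht => ?_⟩
    obtain ⟨t', htt', ht'⟩ := exists_between ht
    obtain ⟨p', hp', hlt⟩ := exists_isFiniteDistribution_lt f₁ f₂ q ht'
    rw [(hasErrorExponent_minOuterChernoff hk hp).unique hE]
    exact (htt'.trans_le hlt).trans_le (hmax p' hp' _ (hasErrorExponent_minOuterChernoff hk hp'))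
  · rintro ⟨-, hmax⟩
    refine ⟨hp, _, hasErrorExponent_minOuterChernoff hk hp, fun q hq E' hE' => ?_⟩
    rw [hE'.unique (hasErrorExponent_minOuterChernoff hk hq)]
    exact hmax q hq.1

/-! ### Affinities of Gaussian laws -/

/-- The densities with respect to `P + Q` are `p / (p + q)` and `q / (p + q)`; as the exponents sum
to `1`, the powers of `p + q` cancel against the density of `P + Q`. -/
lemma affinity_withDensity {Y : Type*} [MeasurableSpace Y] (μ : Measure Y) {p q : Y → ℝ≥0∞}
    (mp : Measurable p) (mq : Measurable q) (hp0 : ∀ y, p y ≠ 0) (hpt : ∀ y, p y ≠ ⊤)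
    (hqt : ∀ y, q y ≠ ⊤) [IsFiniteMeasure (μ.withDensity p)]
    [IsFiniteMeasure (μ.withDensity q)] {lam : ℝ} (hlam : lam ∈ Set.Icc (0 : ℝ) 1) :
    affinity lam (μ.withDensity p) (μ.withDensity q) = ∫⁻ y, p y ^ lam * q y ^ (1 - lam) ∂μ := by
  set P := μ.withDensity p with hP
  set Q := μ.withDensity q with hQ
  have hPQ : P + Q = μ.withDensity (p + q) := (withDensity_add_left mp q).symm
  have hs0 : ∀ y, p y + q y ≠ 0 := fun y h => hp0 y (add_eq_zero.1 h).1
  have hst : ∀ y, p y + q y ≠ ⊤ := fun y => ENNReal.add_ne_top.2 ⟨hpt y, hqt y⟩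
  have hden : ∀ f : Y → ℝ≥0∞, Measurable f →
      μ.withDensity f = (P + Q).withDensity (fun y => f y / (p y + q y)) := fun f mf => by
    rw [hPQ, ← withDensity_mul (g := fun y => f y / (p y + q y)) _ (mp.add mq)
      (mf.div (mp.add mq))]
    congr 1
    ext y
    simp only [Pi.mul_apply, Pi.add_apply]
    rw [ENNReal.mul_div_cancel (hs0 y) (hst y)]
  have hrn : ∀ f : Y → ℝ≥0∞, Measurable f →
      (μ.withDensity f).rnDeriv (P + Q) =ᵐ[P + Q] fun y => f y / (p y + q y) := fun f mf => by
    rw [hden f mf]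
    exact Measure.rnDeriv_withDensity _ (mf.div (mp.add mq))
  have h1 : affinity lam P Q = ∫⁻ y, (p y / (p y + q y)) ^ lam *
      (q y / (p y + q y)) ^ (1 - lam) ∂(P + Q) := by
    refine lintegral_congr_ae ?_
    filter_upwards [hrn p mp, hrn q mq] with y h1 h2
    rw [← hP] at h1
    rw [← hQ] at h2
    rw [h1, h2]
  rw [h1, hPQ, lintegral_withDensity_eq_lintegral_mul
    (g := fun y => (p y / (p y + q y)) ^ lam * (q y / (p y + q y)) ^ (1 - lam)) _ (mp.add mq)
    (((mp.div (mp.add mq)).pow_const _).mul ((mq.div (mp.add mq)).pow_const _))]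
  refine lintegral_congr fun y => ?_
  have hl' : 0 ≤ 1 - lam := sub_nonneg.2 hlam.2
  have e1 : p y + q y = (p y + q y) ^ lam * (p y + q y) ^ (1 - lam) := by
    rw [← ENNReal.rpow_add_of_nonneg _ _ hlam.1 hl']; simp
  have e2 : ∀ z : ℝ≥0∞, ∀ c : ℝ, 0 ≤ c →
      (p y + q y) ^ c * (z / (p y + q y)) ^ c = z ^ c := fun z c hc => by
    rw [← ENNReal.mul_rpow_of_nonneg _ _ hc, ENNReal.mul_div_cancel (hs0 y) (hst y)]
  simp only [Pi.mul_apply, Pi.add_apply]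
  calc _ = ((p y + q y) ^ lam * (p y / (p y + q y)) ^ lam) *
        ((p y + q y) ^ (1 - lam) * (q y / (p y + q y)) ^ (1 - lam)) := by
        rw [mul_mul_mul_comm, ← e1]
    _ = _ := by rw [e2 _ _ hlam.1, e2 _ _ hl']

lemma affinity_self {Y : Type*} [MeasurableSpace Y] (P : Measure Y) [IsProbabilityMeasure P]
    {lam : ℝ} (hlam : lam ∈ Set.Icc (0 : ℝ) 1) : affinity lam P P = 1 := by
  have h1 : IsFiniteMeasure (P.withDensity 1) := by rw [withDensity_one]; infer_instance
  have := affinity_withDensity P (p := 1) (q := 1) measurable_one measurable_one (by simp) (by simp)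
    (by simp) hlam
  simpa using this

/-- Completing the square: `lam * (1 - lam) * (m₁ - m₂) ^ 2` is the variance of the two means under
the weights `lam` and `1 - lam`. -/
lemma gaussianPDFReal_rpow_mul_rpow (m₁ m₂ : ℝ) {V : ℝ≥0} (hV : V ≠ 0) (lam x : ℝ) :
    gaussianPDFReal m₁ V x ^ lam * gaussianPDFReal m₂ V x ^ (1 - lam)
      = Real.exp (-(lam * (1 - lam) * (m₁ - m₂) ^ 2 / (2 * V))) *
        gaussianPDFReal (lam * m₁ + (1 - lam) * m₂) V x := by
  have hV' : (0 : ℝ) < V := NNReal.coe_pos.2 (pos_iff_ne_zero.2 hV)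
  simp only [gaussianPDFReal]
  set c : ℝ := (√(2 * Real.pi * V))⁻¹ with hc
  have hc0 : 0 < c := by positivity
  rw [Real.mul_rpow hc0.le (Real.exp_pos _).le, Real.mul_rpow hc0.le (Real.exp_pos _).le,
    ← Real.exp_mul, ← Real.exp_mul]
  have h1 : c ^ lam * c ^ (1 - lam) = c := by rw [← Real.rpow_add hc0]; simp
  calc _ = (c ^ lam * c ^ (1 - lam)) * (Real.exp (-(x - m₁) ^ 2 / (2 * V) * lam) *
        Real.exp (-(x - m₂) ^ 2 / (2 * V) * (1 - lam))) := by ring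
    _ = c * (Real.exp (-(lam * (1 - lam) * (m₁ - m₂) ^ 2 / (2 * V))) *
        Real.exp (-(x - (lam * m₁ + (1 - lam) * m₂)) ^ 2 / (2 * V))) := by
        rw [h1, ← Real.exp_add, ← Real.exp_add]
        congr 2
        field_simp
        ring
    _ = _ := by ring

/-- The degenerate case `V = 0` is needed for the zero sensing vector, whose observation is constant
under all hypotheses. -/
lemma negLog_affinity_gaussianReal {m₁ m₂ : ℝ} {V : ℝ≥0} (hV : V = 0 → m₁ = m₂) {lam : ℝ}
    (hlam : lam ∈ Set.Icc (0 : ℝ) 1) :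
    negLog (affinity lam (gaussianReal m₁ V) (gaussianReal m₂ V))
      = ENNReal.ofReal (lam * (1 - lam) * (m₁ - m₂) ^ 2 / (2 * V)) := by
  by_cases h0 : V = 0
  · rw [hV h0, affinity_self _ hlam]
    simp
  have h1 : ∀ m, gaussianReal m V = volume.withDensity (gaussianPDF m V) := fun m =>
    gaussianReal_of_var_ne_zero m h0
  have hf : ∀ m, IsFiniteMeasure ((volume : Measure ℝ).withDensity (gaussianPDF m V)) := fun m => by
    rw [← h1]; infer_instance
  have h2 : ∀ x, gaussianPDF m₁ V x ^ lam * gaussianPDF m₂ V x ^ (1 - lam)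
      = ENNReal.ofReal (Real.exp (-(lam * (1 - lam) * (m₁ - m₂) ^ 2 / (2 * V)))) *
        gaussianPDF (lam * m₁ + (1 - lam) * m₂) V x := fun x => by
    simp only [gaussianPDF]
    rw [ENNReal.ofReal_rpow_of_pos (gaussianPDFReal_pos _ _ _ h0),
      ENNReal.ofReal_rpow_of_pos (gaussianPDFReal_pos _ _ _ h0),
      ← ENNReal.ofReal_mul (Real.rpow_nonneg (gaussianPDFReal_nonneg _ _ _) _),
      gaussianPDFReal_rpow_mul_rpow _ _ h0, ENNReal.ofReal_mul (Real.exp_pos _).le]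
  rw [h1, h1, affinity_withDensity _ (measurable_gaussianPDF _ _) (measurable_gaussianPDF _ _)
    (fun x => (gaussianPDF_pos _ h0 x).ne') (fun _ => gaussianPDF_ne_top)
    (fun _ => gaussianPDF_ne_top) hlam]
  simp only [h2]
  rw [lintegral_const_mul _ (measurable_gaussianPDF _ _), lintegral_gaussianPDF_eq_one _ h0, mul_one,
    negLog_ofReal (Real.exp_pos _), Real.log_exp, neg_neg]

/-- Comparison of characteristic functions, which factor over the independent coordinates. -/
lemma map_pi_gaussianReal {n : ℕ} (μ : Fin n → ℝ) (v : ℝ≥0) (a : Fin n → ℝ) :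
    (Measure.pi fun i => gaussianReal (μ i) v).map (fun x => ∑ i, a i * x i)
      = gaussianReal (∑ i, a i * μ i) ((∑ i, (a i ^ 2).toNNReal) * v) := by
  have : IsProbabilityMeasure
      ((Measure.pi fun i => gaussianReal (μ i) v).map (fun x => ∑ i, a i * x i)) :=
    Measure.isProbabilityMeasure_map (Measurable.aemeasurable (by fun_prop))
  refine Measure.ext_of_charFun (funext fun t => ?_)
  rw [charFun_gaussianReal, charFun_apply_real, integral_map (Measurable.aemeasurable (by fun_prop))
    (by fun_prop)]
  have h1 : ∀ x : Fin n → ℝ, Complex.exp (t * ((∑ i, a i * x i : ℝ) : ℂ) * Complex.I)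
      = ∏ i, Complex.exp (((t * a i : ℝ) : ℂ) * x i * Complex.I) := fun x => by
    rw [← Complex.exp_sum]
    push_cast
    rw [Finset.mul_sum, Finset.sum_mul]
    congr 1
    exact Finset.sum_congr rfl fun i _ => by ring
  simp only [h1]
  rw [integral_fintype_prod_eq_prod (𝕜 := ℂ)
    (f := fun i (x : ℝ) => Complex.exp (((t * a i : ℝ) : ℂ) * x * Complex.I))]
  have h2 : ∀ i, ∫ x : ℝ, Complex.exp (((t * a i : ℝ) : ℂ) * x * Complex.I) ∂(gaussianReal (μ i) v)
      = Complex.exp (((t * a i : ℝ) : ℂ) * μ i * Complex.I - v * ((t * a i : ℝ) : ℂ) ^ 2 / 2) :=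
    fun i => by rw [← charFun_apply_real, charFun_gaussianReal]
  simp only [h2]
  rw [← Complex.exp_sum, Finset.sum_sub_distrib]
  have h3 : ((((∑ i, (a i ^ 2).toNNReal) * v : ℝ≥0) : ℝ) : ℂ) = (∑ i, (a i : ℂ) ^ 2) * v := by
    push_cast
    congr 1
    refine Finset.sum_congr rfl fun i _ => ?_
    rw [Real.coe_toNNReal _ (sq_nonneg _)]
    push_cast
    rfl
  have h4 : (((((∑ i, (a i ^ 2).toNNReal) * v : ℝ≥0) : ℝ≥0) : ℝ) : ℂ)
      = (∑ i, (a i : ℂ) ^ 2) * v := h3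
  rw [h4]
  congr 1
  push_cast
  rw [Finset.mul_sum, Finset.sum_mul, Finset.sum_mul, Finset.sum_mul, Finset.sum_div]
  congr 1
  · exact Finset.sum_congr rfl fun i _ => by ring
  · exact Finset.sum_congr rfl fun i _ => by ring

lemma obsLaw_gaussianReal {n k : ℕ} (μ₁ μ₂ : ℝ) (v : ℝ≥0) (K : Hypothesis n k) (a : Fin n → ℝ) :
    obsLaw (gaussianReal μ₂ v) (gaussianReal μ₁ v) K a
      = gaussianReal (∑ i, a i * if i ∈ K.1 then μ₁ else μ₂) ((∑ i, (a i ^ 2).toNNReal) * v) := by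
  rw [← map_pi_gaussianReal, obsLaw]
  congr 2
  ext i : 1
  split_ifs <;> rfl

/-! ### One anomalous Gaussian variable -/

/-- The hypothesis that only the `i`-th variable is anomalous. -/
noncomputable def singleHypothesis (n : ℕ) : Fin n ≃ Hypothesis n 1 :=
  Equiv.ofBijective (fun i => ⟨{i}, Finset.card_singleton i⟩)
    ⟨fun i j h => Finset.singleton_injective (Subtype.ext_iff.1 h), fun K => by
      obtain ⟨i, hi⟩ := Finset.card_eq_one.1 K.2
      exact ⟨i, Subtype.ext hi.symm⟩⟩

@[simp] lemma singleHypothesis_val {n : ℕ} (i : Fin n) : (singleHypothesis n i).1 = {i} := rfl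

/-- The Chernoff information between the hypotheses that the `i`-th, respectively the `j`-th,
variable is anomalous, for Gaussian laws with means at distance `δ` and variance `v`. -/
noncomputable def pairInfo {n : ℕ} (δ v : ℝ) (a : Fin n → ℝ) (i j : Fin n) : ℝ :=
  δ ^ 2 * (a i - a j) ^ 2 / (8 * v * ∑ l, a l ^ 2)

section Gaussian

variable {n : ℕ} (μ₁ μ₂ : ℝ) {v : ℝ≥0}

lemma pairInfo_nonneg (δ : ℝ) (v : ℝ≥0) (a : Fin n → ℝ) (i j : Fin n) : 0 ≤ pairInfo δ v a i j :=
  div_nonneg (by positivity) (mul_nonneg (by positivity) (Finset.sum_nonneg fun _ _ => sq_nonneg _))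

lemma negLog_affinity_obsLaw (hv : v ≠ 0) (i j : Fin n) (a : Fin n → ℝ) {lam : ℝ}
    (hlam : lam ∈ Set.Icc (0 : ℝ) 1) :
    negLog (affinity lam (obsLaw (gaussianReal μ₂ v) (gaussianReal μ₁ v) (singleHypothesis n i) a)
      (obsLaw (gaussianReal μ₂ v) (gaussianReal μ₁ v) (singleHypothesis n j) a))
      = ENNReal.ofReal (4 * (lam * (1 - lam)) * pairInfo (μ₁ - μ₂) v a i j) := by
  have hmean : ∀ i : Fin n, (∑ l, a l * if l ∈ (singleHypothesis n i).1 then μ₁ else μ₂)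
      = a i * (μ₁ - μ₂) + ∑ l, a l * μ₂ := fun i => by
    have : ∀ l, (a l * if l ∈ (singleHypothesis n i).1 then μ₁ else μ₂)
        = (if l = i then a l * (μ₁ - μ₂) else 0) + a l * μ₂ := fun l => by
      simp only [singleHypothesis_val, Finset.mem_singleton]
      split_ifs <;> ring
    simp only [this]
    rw [Finset.sum_add_distrib, Finset.sum_ite_eq' Finset.univ i]
    simp
  rw [obsLaw_gaussianReal, obsLaw_gaussianReal, negLog_affinity_gaussianReal _ hlam]
  · rw [hmean, hmean, pairInfo]
    congr 1
    push_cast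
    have : ∀ l, ((a l ^ 2).toNNReal : ℝ) = a l ^ 2 := fun l => Real.coe_toNNReal _ (sq_nonneg _)
    simp only [this]
    rw [show (8 * (v : ℝ) * ∑ l, a l ^ 2) = 4 * (2 * ((∑ l, a l ^ 2) * v)) by ring, mul_div_assoc',
      mul_assoc 4 (lam * (1 - lam)), mul_div_mul_left _ _ (by norm_num : (4 : ℝ) ≠ 0)]
    congr 1
    ring
  · intro h0
    have h1 : ∀ l, a l = 0 := fun l => by
      have h2 := (mul_eq_zero.1 h0).resolve_right hv
      have h3 := Finset.sum_eq_zero_iff.1 h2 l (Finset.mem_univ l)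
      exact pow_eq_zero_iff (two_ne_zero) |>.1 (le_antisymm (Real.toNNReal_eq_zero.1 h3) (sq_nonneg _))
    simp [h1]

lemma four_mul_le_one {lam : ℝ} : 4 * (lam * (1 - lam)) ≤ 1 := by nlinarith [sq_nonneg (2 * lam - 1)]

/-- The exponent enters only through the factor `4 * lam * (1 - lam)`, which does not involve `a`
and is maximal, equal to `1`, at `lam = 1/2`. So the supremum commutes with the integral. -/
lemma outerChernoff_gaussianReal (hv : v ≠ 0) (p : Measure (Fin n → ℝ)) (i j : Fin n) :
    outerChernoff (gaussianReal μ₂ v) (gaussianReal μ₁ v) p (singleHypothesis n i)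
      (singleHypothesis n j) = ∫⁻ a, ENNReal.ofReal (pairInfo (μ₁ - μ₂) v a i j) ∂p := by
  refine le_antisymm (iSup₂_le fun lam hlam => lintegral_mono fun a => ?_) ?_
  · simp only [negLog_affinity_obsLaw μ₁ μ₂ hv i j a hlam]
    exact ENNReal.ofReal_le_ofReal (mul_le_of_le_one_left (pairInfo_nonneg _ _ _ _ _) four_mul_le_one)
  · have hh : (1 / 2 : ℝ) ∈ Set.Icc (0 : ℝ) 1 := by norm_num
    refine le_iSup₂_of_le (1 / 2 : ℝ) hh (lintegral_mono fun a => ?_)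
    simp only [negLog_affinity_obsLaw μ₁ μ₂ hv i j a hh]
    norm_num

lemma chernoffInfo_gaussianReal (hv : v ≠ 0) (a : Fin n → ℝ) (i j : Fin n) :
    chernoffInfo (obsLaw (gaussianReal μ₂ v) (gaussianReal μ₁ v) (singleHypothesis n i) a)
      (obsLaw (gaussianReal μ₂ v) (gaussianReal μ₁ v) (singleHypothesis n j) a)
      = ENNReal.ofReal (pairInfo (μ₁ - μ₂) v a i j) := by
  refine le_antisymm (iSup₂_le fun lam hlam => ?_) ?_
  · rw [negLog_affinity_obsLaw μ₁ μ₂ hv i j a hlam]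
    exact ENNReal.ofReal_le_ofReal (mul_le_of_le_one_left (pairInfo_nonneg _ _ _ _ _) four_mul_le_one)
  · have hh : (1 / 2 : ℝ) ∈ Set.Icc (0 : ℝ) 1 := by norm_num
    refine le_iSup₂_of_le (1 / 2 : ℝ) hh ?_
    rw [negLog_affinity_obsLaw μ₁ μ₂ hv i j a hh]
    norm_num

lemma sumChernoff_gaussianReal (hv : v ≠ 0) (a : Fin n → ℝ) :
    sumChernoff (gaussianReal μ₂ v) (gaussianReal μ₁ v) 1 a
      = ∑ ij ∈ (Finset.univ : Finset (Fin n)).offDiag,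
          ENNReal.ofReal (pairInfo (μ₁ - μ₂) v a ij.1 ij.2) := by
  rw [sumChernoff]
  symm
  refine Finset.sum_equiv ((singleHypothesis n).prodCongr (singleHypothesis n)) (fun ij => ?_)
    fun ij _ => (chernoffInfo_gaussianReal μ₁ μ₂ hv a ij.1 ij.2).symm
  simp [Finset.mem_offDiag]

lemma sum_pairInfo (δ w : ℝ) (a : Fin n → ℝ) :
    ∑ ij ∈ (Finset.univ : Finset (Fin n)).offDiag, pairInfo δ w a ij.1 ij.2
      = δ ^ 2 * (n * ∑ l, a l ^ 2 - (∑ l, a l) ^ 2) / (4 * w * ∑ l, a l ^ 2) := by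
  have h1 : ∑ ij ∈ (Finset.univ : Finset (Fin n)).offDiag, pairInfo δ w a ij.1 ij.2
      = ∑ ij : Fin n × Fin n, pairInfo δ w a ij.1 ij.2 := by
    refine Finset.sum_subset (Finset.subset_univ _) fun ij _ h => ?_
    have : ij.1 = ij.2 := by simpa [Finset.mem_offDiag] using h
    simp [pairInfo, this]
  have h2 : ∑ i, ∑ j, (a i - a j) ^ 2 = 2 * (n * ∑ l, a l ^ 2 - (∑ l, a l) ^ 2) := by
    have : ∀ i j, (a i - a j) ^ 2 = a i ^ 2 - 2 * (a i * a j) + a j ^ 2 := fun i j => by ring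
    simp only [this, Finset.sum_add_distrib, Finset.sum_sub_distrib, ← Finset.mul_sum,
      Finset.sum_const, Finset.card_univ, Fintype.card_fin, nsmul_eq_mul, ← Finset.sum_mul]
    ring
  rw [h1, Fintype.sum_prod_type]
  simp only [pairInfo, ← Finset.sum_div, ← Finset.mul_sum, h2]
  rw [show 8 * w * ∑ l, a l ^ 2 = 2 * (4 * w * ∑ l, a l ^ 2) by ring,
    show δ ^ 2 * (2 * (n * ∑ l, a l ^ 2 - (∑ l, a l) ^ 2))
      = 2 * (δ ^ 2 * (n * ∑ l, a l ^ 2 - (∑ l, a l) ^ 2)) by ring,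
    mul_div_mul_left _ _ two_ne_zero]

lemma sumChernoff_gaussianReal_eq (hv : v ≠ 0) (a : Fin n → ℝ) :
    sumChernoff (gaussianReal μ₂ v) (gaussianReal μ₁ v) 1 a = ENNReal.ofReal
      ((μ₁ - μ₂) ^ 2 * (n * ∑ l, a l ^ 2 - (∑ l, a l) ^ 2) / (4 * v * ∑ l, a l ^ 2)) := by
  rw [sumChernoff_gaussianReal μ₁ μ₂ hv, ← sum_pairInfo,
    ENNReal.ofReal_sum_of_nonneg fun _ _ => pairInfo_nonneg _ _ _ _ _]

/-- Drop the term `(∑ l, a l) ^ 2`. For `a = 0` division by zero gives the correct value `0`. -/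
lemma sumChernoff_gaussianReal_le (hv : v ≠ 0) (a : Fin n → ℝ) :
    sumChernoff (gaussianReal μ₂ v) (gaussianReal μ₁ v) 1 a
      ≤ ENNReal.ofReal ((μ₁ - μ₂) ^ 2 * n / (4 * v)) := by
  have hv' : (0 : ℝ) < v := NNReal.coe_pos.2 (pos_iff_ne_zero.2 hv)
  rw [sumChernoff_gaussianReal_eq μ₁ μ₂ hv]
  refine ENNReal.ofReal_le_ofReal ?_
  have hs : 0 ≤ ∑ l, a l ^ 2 := Finset.sum_nonneg fun _ _ => sq_nonneg _
  rcases hs.eq_or_lt with h0 | h0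
  · rw [← h0]
    simp only [mul_zero, div_zero]
    positivity
  · rw [div_le_div_iff₀ (by positivity) (by positivity)]
    have : 0 ≤ (μ₁ - μ₂) ^ 2 * (∑ l, a l) ^ 2 * (4 * v) := by positivity
    linarith

lemma twoPoint_sums (hn : 2 ≤ n) : ∑ l, twoPoint n l = 0 ∧ ∑ l, twoPoint n l ^ 2 = 1 := by
  obtain ⟨m, rfl⟩ := Nat.exists_eq_add_of_le' hn
  have h2 : (√2 : ℝ) ^ 2 = 2 := Real.sq_sqrt (by norm_num)
  constructor
  · rw [Fin.sum_univ_succ, Fin.sum_univ_succ]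
    simp [twoPoint]
    ring
  · rw [Fin.sum_univ_succ, Fin.sum_univ_succ]
    simp [twoPoint, div_pow, h2]
    norm_num

lemma sumChernoff_twoPoint (hv : v ≠ 0) (hn : 2 ≤ n) :
    sumChernoff (gaussianReal μ₂ v) (gaussianReal μ₁ v) 1 (twoPoint n)
      = ENNReal.ofReal ((μ₁ - μ₂) ^ 2 * n / (4 * v)) := by
  rw [sumChernoff_gaussianReal_eq μ₁ μ₂ hv, (twoPoint_sums hn).1, (twoPoint_sums hn).2]
  simp

lemma maximizesSumChernoff_twoPoint (hv : v ≠ 0) (hn : 2 ≤ n) :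
    MaximizesSumChernoff (gaussianReal μ₂ v) (gaussianReal μ₁ v) 1 (twoPoint n) := fun b => by
  rw [sumChernoff_twoPoint μ₁ μ₂ hv hn]
  exact sumChernoff_gaussianReal_le μ₁ μ₂ hv b

lemma isFiniteDistribution_uniform {ι : Type*} [Fintype ι] [Nonempty ι] {N : ℕ}
    (hN : Fintype.card ι = N) (x : ι → Fin n → ℝ) :
    IsFiniteDistribution ((N : ℝ≥0∞)⁻¹ • ∑ i, Measure.dirac (x i)) := by
  classical
  subst hN
  refine ⟨⟨?_⟩, Finset.univ.image x, ?_⟩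
  · rw [Measure.smul_apply, Measure.finsetSum_apply]
    simp only [measure_univ, Finset.sum_const, Finset.card_univ, nsmul_eq_mul, mul_one, smul_eq_mul]
    exact ENNReal.inv_mul_cancel (by simp) (ENNReal.natCast_ne_top _)
  · rw [Measure.smul_apply, Measure.finsetSum_apply, Finset.sum_eq_zero, smul_zero]
    intro i _
    rw [Measure.dirac_apply]
    simp

lemma isFiniteDistribution_permUniform (a : Fin n → ℝ) : IsFiniteDistribution (permUniform a) :=
  isFiniteDistribution_uniform (by rw [Fintype.card_perm, Fintype.card_fin]) _

lemma isFiniteDistribution_separateSampling (hn : 1 ≤ n) :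
    IsFiniteDistribution (separateSampling n) :=
  have : Nonempty (Fin n) := ⟨⟨0, hn⟩⟩
  isFiniteDistribution_uniform (Fintype.card_fin n) _

lemma pairInfo_perm (δ w : ℝ) (a : Fin n → ℝ) (τ : Equiv.Perm (Fin n)) (i j : Fin n) :
    pairInfo δ w (fun l => a (τ l)) i j = pairInfo δ w a (τ i) (τ j) := by
  rw [pairInfo, pairInfo, Equiv.sum_comp τ fun l => a l ^ 2]

lemma lintegral_permUniform (a : Fin n → ℝ) (F : (Fin n → ℝ) → ℝ≥0∞) :
    ∫⁻ b, F b ∂(permUniform a)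
      = (n.factorial : ℝ≥0∞)⁻¹ * ∑ τ : Equiv.Perm (Fin n), F fun i => a (τ i) := by
  rw [permUniform, lintegral_smul_measure, lintegral_finsetSum_measure]
  simp

lemma exists_perm_pair {i j i' j' : Fin n} (h : i ≠ j) (h' : i' ≠ j') :
    ∃ σ : Equiv.Perm (Fin n), σ i = i' ∧ σ j = j' := by
  have hx : Equiv.swap i i' j ≠ i' := fun hc => h
    ((Equiv.swap i i').injective ((Equiv.swap_apply_left i i').trans hc.symm))
  refine ⟨Equiv.swap (Equiv.swap i i' j) j' * Equiv.swap i i', ?_, ?_⟩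
  · rw [Equiv.Perm.mul_apply, Equiv.swap_apply_left, Equiv.swap_apply_of_ne_of_ne hx.symm h']
  · rw [Equiv.Perm.mul_apply, Equiv.swap_apply_left]

/-- Permutations act transitively on ordered pairs of distinct indices, so symmetrizing gives every
pair the mean over all pairs. -/
lemma offDiag_card_mul_outerChernoff_permUniform (hv : v ≠ 0) (a : Fin n → ℝ) {i j : Fin n}
    (hij : i ≠ j) :
    ((Finset.univ : Finset (Fin n)).offDiag.card : ℝ≥0∞) *
      outerChernoff (gaussianReal μ₂ v) (gaussianReal μ₁ v) (permUniform a) (singleHypothesis n i)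
      (singleHypothesis n j) = sumChernoff (gaussianReal μ₂ v) (gaussianReal μ₁ v) 1 a := by
  set c : Fin n → Fin n → ℝ≥0∞ := fun i j => ENNReal.ofReal (pairInfo (μ₁ - μ₂) v a i j) with hc
  have hOC : ∀ i j : Fin n, outerChernoff (gaussianReal μ₂ v) (gaussianReal μ₁ v) (permUniform a)
      (singleHypothesis n i) (singleHypothesis n j)
      = (n.factorial : ℝ≥0∞)⁻¹ * ∑ τ : Equiv.Perm (Fin n), c (τ i) (τ j) := fun i j => by
    rw [outerChernoff_gaussianReal μ₁ μ₂ hv, lintegral_permUniform]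
    simp only [pairInfo_perm, hc]
  have hconst : ∀ ij ∈ (Finset.univ : Finset (Fin n)).offDiag,
      ∑ τ : Equiv.Perm (Fin n), c (τ ij.1) (τ ij.2) = ∑ τ : Equiv.Perm (Fin n), c (τ i) (τ j) := by
    intro ij h
    obtain ⟨σ, h1, h2⟩ := exists_perm_pair hij (Finset.mem_offDiag.1 h).2.2
    -- Reindexing by `τ ↦ τ * σ`, where `σ` carries `(i, j)` to the given pair.
    rw [← Equiv.sum_comp (Equiv.mulRight σ) fun τ : Equiv.Perm (Fin n) => c (τ i) (τ j)]
    refine Finset.sum_congr rfl fun τ _ => ?_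
    simp [h1, h2]
  have hsum : ∀ τ : Equiv.Perm (Fin n),
      ∑ ij ∈ (Finset.univ : Finset (Fin n)).offDiag, c (τ ij.1) (τ ij.2)
        = sumChernoff (gaussianReal μ₂ v) (gaussianReal μ₁ v) 1 a := fun τ => by
    rw [sumChernoff_gaussianReal μ₁ μ₂ hv]
    refine Finset.sum_equiv (τ.prodCongr τ) (fun ij => ?_) fun ij _ => rfl
    simp [Finset.mem_offDiag]
  rw [hOC, mul_left_comm, ← nsmul_eq_mul, ← Finset.sum_const, ← Finset.sum_congr rfl hconst,
    Finset.sum_comm, Finset.sum_congr rfl fun τ _ => hsum τ, Finset.sum_const, Finset.card_univ,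
    Fintype.card_perm, Fintype.card_fin, nsmul_eq_mul, ← mul_assoc,
    ENNReal.inv_mul_cancel (by exact_mod_cast n.factorial_ne_zero) (ENNReal.natCast_ne_top _),
    one_mul]

lemma measurable_pairInfo (δ w : ℝ) (i j : Fin n) :
    Measurable fun a : Fin n → ℝ => pairInfo δ w a i j := by
  unfold pairInfo
  fun_prop

/-- A minimum is at most each term; summing over pairs, the sum moves inside the integral. -/
lemma offDiag_card_mul_minOuterChernoff_le (hv : v ≠ 0) (q : Measure (Fin n → ℝ)) :
    ((Finset.univ : Finset (Fin n)).offDiag.card : ℝ≥0∞) *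
      minOuterChernoff (gaussianReal μ₂ v) (gaussianReal μ₁ v) 1 q
      ≤ ∫⁻ a, sumChernoff (gaussianReal μ₂ v) (gaussianReal μ₁ v) 1 a ∂q := by
  simp only [sumChernoff_gaussianReal μ₁ μ₂ hv]
  rw [lintegral_finsetSum _ fun ij _ => (measurable_pairInfo _ _ _ _).ennreal_ofReal,
    ← nsmul_eq_mul, ← Finset.sum_const]
  refine Finset.sum_le_sum fun ij h => ?_
  rw [← outerChernoff_gaussianReal μ₁ μ₂ hv]
  exact (iInf_le _ _).trans ((iInf_le _ _).trans (iInf_le _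
    ((singleHypothesis n).injective.ne (Finset.mem_offDiag.1 h).2.2)))

theorem maximizesMinOuterChernoff_permUniform (hv : v ≠ 0) {a : Fin n → ℝ}
    (ha : MaximizesSumChernoff (gaussianReal μ₂ v) (gaussianReal μ₁ v) 1 a) :
    MaximizesMinOuterChernoff (gaussianReal μ₂ v) (gaussianReal μ₁ v) 1 (permUniform a) := by
  refine ⟨(isFiniteDistribution_permUniform a).1, fun q hq => le_iInf fun K => le_iInf fun L =>
    le_iInf fun hKL => ?_⟩
  obtain ⟨i, rfl⟩ := (singleHypothesis n).surjective K
  obtain ⟨j, rfl⟩ := (singleHypothesis n).surjective L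
  have hij : i ≠ j := fun h => hKL (h ▸ rfl)
  have h0 : ((Finset.univ : Finset (Fin n)).offDiag.card : ℝ≥0∞) ≠ 0 := by
    have : 0 < (Finset.univ : Finset (Fin n)).offDiag.card :=
      Finset.card_pos.2 ⟨(i, j), by simpa [Finset.mem_offDiag] using hij⟩
    exact_mod_cast this.ne'
  rw [← ENNReal.mul_le_mul_iff_right h0 (ENNReal.natCast_ne_top _),
    offDiag_card_mul_outerChernoff_permUniform μ₁ μ₂ hv a hij]
  refine (offDiag_card_mul_minOuterChernoff_le μ₁ μ₂ hv q).trans ?_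
  calc _ ≤ ∫⁻ _, sumChernoff (gaussianReal μ₂ v) (gaussianReal μ₁ v) 1 a ∂q :=
        lintegral_mono fun b => ha b
    _ = _ := by simp

lemma minOuterChernoff_eq (hn : 2 ≤ n) {f₁ f₂ : Measure ℝ} {p : Measure (Fin n → ℝ)} {E : ℝ≥0∞}
    (h : ∀ i j : Fin n, i ≠ j →
      outerChernoff f₁ f₂ p (singleHypothesis n i) (singleHypothesis n j) = E) :
    minOuterChernoff f₁ f₂ 1 p = E := by
  have h' : ∀ K L : Hypothesis n 1, K ≠ L → outerChernoff f₁ f₂ p K L = E := fun K L hKL => by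
    obtain ⟨i, rfl⟩ := (singleHypothesis n).surjective K
    obtain ⟨j, rfl⟩ := (singleHypothesis n).surjective L
    exact h i j fun h => hKL (h ▸ rfl)
  refine le_antisymm ?_ (le_iInf fun K => le_iInf fun L => le_iInf fun hKL => (h' K L hKL).ge)
  have hne : singleHypothesis n ⟨0, by omega⟩ ≠ singleHypothesis n ⟨1, by omega⟩ :=
    (singleHypothesis n).injective.ne (by simp)
  exact iInf_le_of_le _ (iInf_le_of_le _ (iInf_le_of_le hne (h' _ _ hne).le))

lemma minOuterChernoff_permUniform_twoPoint (hv : v ≠ 0) (hn : 2 ≤ n) :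
    minOuterChernoff (gaussianReal μ₂ v) (gaussianReal μ₁ v) 1 (permUniform (twoPoint n))
      = ENNReal.ofReal ((μ₁ - μ₂) ^ 2 / (4 * (v : ℝ) * ((n : ℝ) - 1))) := by
  have hv' : (0 : ℝ) < v := NNReal.coe_pos.2 (pos_iff_ne_zero.2 hv)
  have hn' : (2 : ℝ) ≤ n := by exact_mod_cast hn
  refine minOuterChernoff_eq hn fun i j hij => ?_
  have hcard : ((Finset.univ : Finset (Fin n)).offDiag.card : ℝ≥0∞)
      = ENNReal.ofReal (n * ((n : ℝ) - 1)) := by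
    rw [Finset.offDiag_card, Finset.card_univ, Fintype.card_fin, ← ENNReal.ofReal_natCast,
      Nat.cast_sub (Nat.le_mul_self n)]
    push_cast
    congr 1
    ring
  have h1 := offDiag_card_mul_outerChernoff_permUniform μ₁ μ₂ hv (twoPoint n) hij
  have hpos : (0 : ℝ) < n * ((n : ℝ) - 1) := by nlinarith
  rw [hcard, sumChernoff_twoPoint μ₁ μ₂ hv hn] at h1
  have h0 : ENNReal.ofReal (n * ((n : ℝ) - 1)) ≠ 0 :=
    (ENNReal.ofReal_pos.2 hpos).ne'
  rw [← ENNReal.mul_right_inj h0 ENNReal.ofReal_ne_top, h1, ← ENNReal.ofReal_mul hpos.le]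
  congr 1
  have : (n : ℝ) - 1 ≠ 0 := by linarith
  field_simp

lemma minOuterChernoff_separateSampling (hv : v ≠ 0) (hn : 2 ≤ n) :
    minOuterChernoff (gaussianReal μ₂ v) (gaussianReal μ₁ v) 1 (separateSampling n)
      = ENNReal.ofReal ((μ₁ - μ₂) ^ 2 / (4 * (v : ℝ) * (n : ℝ))) := by
  have hv' : (0 : ℝ) < v := NNReal.coe_pos.2 (pos_iff_ne_zero.2 hv)
  have hn' : (0 : ℝ) < n := by exact_mod_cast (by omega : 0 < n)
  refine minOuterChernoff_eq hn fun i j hij => ?_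
  rw [outerChernoff_gaussianReal μ₁ μ₂ hv, separateSampling, lintegral_smul_measure,
    lintegral_finsetSum_measure]
  simp only [lintegral_dirac]
  -- Only the basis vectors at `i` and at `j` distinguish the two hypotheses, each contributing `(μ₁
  -- - μ₂) ^ 2 / (8 * v)`.
  have h1 : ∀ l : Fin n, pairInfo (μ₁ - μ₂) v (Pi.single l 1) i j
      = (if l = i then (μ₁ - μ₂) ^ 2 / (8 * v) else 0)
        + (if l = j then (μ₁ - μ₂) ^ 2 / (8 * v) else 0) := fun l => by
    have h2 : ∑ l', (Pi.single l 1 : Fin n → ℝ) l' ^ 2 = 1 := by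
      simp [Pi.single_apply]
    rw [pairInfo, h2]
    by_cases hi : l = i
    · subst hi
      simp [hij, hij.symm]
    · by_cases hj : l = j
      · subst hj
        simp [hij, hij.symm]
      · simp [Ne.symm hi, Ne.symm hj, hi, hj]
  rw [← ENNReal.ofReal_sum_of_nonneg fun l _ => pairInfo_nonneg _ _ _ _ _]
  simp only [h1]
  rw [Finset.sum_add_distrib, Finset.sum_ite_eq' Finset.univ i, Finset.sum_ite_eq' Finset.univ j]
  simp only [Finset.mem_univ, if_true]
  rw [← ENNReal.ofReal_natCast, ← ENNReal.ofReal_inv_of_pos hn', smul_eq_mul,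
    ← ENNReal.ofReal_mul (by positivity)]
  congr 1
  field_simp
  ring

end Gaussian

end CompressedTesting

theorem theorem4 (n : ℕ) (hn : 1 ≤ n) :
    -- General `k`, `f₁`, `f₂`: maximizing the error exponent is maximizing the minimal `OC`.
    (∀ (k : ℕ) (f₁ f₂ : Measure ℝ), k ≤ n → IsProbabilityMeasure f₁ → IsProbabilityMeasure f₂ →
      ∀ p : Measure (Fin n → ℝ), IsFiniteDistribution p →
        HasErrorExponent f₁ f₂ k p (minOuterChernoff f₁ f₂ k p) ∧
        (MaximizesErrorExponent f₁ f₂ k p ↔ MaximizesMinOuterChernoff f₁ f₂ k p)) ∧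
    -- One anomalous variable of law `N(μ₁, v)`, the other ones of law `N(μ₂, v)`, where `v > 0`.
    (∀ (μ₁ μ₂ : ℝ) (v : ℝ≥0), v ≠ 0 →
      (∀ a : Fin n → ℝ, MaximizesSumChernoff (gaussianReal μ₂ v) (gaussianReal μ₁ v) 1 a →
        MaximizesMinOuterChernoff (gaussianReal μ₂ v) (gaussianReal μ₁ v) 1 (permUniform a) ∧
        MaximizesErrorExponent (gaussianReal μ₂ v) (gaussianReal μ₁ v) 1 (permUniform a)) ∧
      (2 ≤ n →
        MaximizesSumChernoff (gaussianReal μ₂ v) (gaussianReal μ₁ v) 1 (twoPoint n) ∧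
        HasErrorExponent (gaussianReal μ₂ v) (gaussianReal μ₁ v) 1 (permUniform (twoPoint n))
          (ENNReal.ofReal ((μ₁ - μ₂) ^ 2 / (4 * (v : ℝ) * ((n : ℝ) - 1)))) ∧
        HasErrorExponent (gaussianReal μ₂ v) (gaussianReal μ₁ v) 1 (separateSampling n)
          (ENNReal.ofReal ((μ₁ - μ₂) ^ 2 / (4 * (v : ℝ) * (n : ℝ)))) ∧
        (μ₁ - μ₂) ^ 2 / (4 * (v : ℝ) * ((n : ℝ) - 1))
          = (n : ℝ) / ((n : ℝ) - 1) * ((μ₁ - μ₂) ^ 2 / (4 * (v : ℝ) * (n : ℝ))))) := by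
  refine ⟨fun k f₁ f₂ hk h₁ h₂ p hp =>
    ⟨hasErrorExponent_minOuterChernoff hk hp, maximizesErrorExponent_iff hk hp⟩,
    fun μ₁ μ₂ v hv => ⟨fun a ha => ?_, fun hn2 => ⟨maximizesSumChernoff_twoPoint μ₁ μ₂ hv hn2,
      ?_, ?_, ?_⟩⟩⟩
  · have h := maximizesMinOuterChernoff_permUniform μ₁ μ₂ hv ha
    exact ⟨h, (maximizesErrorExponent_iff hn (isFiniteDistribution_permUniform a)).2 h⟩
  · rw [← minOuterChernoff_permUniform_twoPoint μ₁ μ₂ hv hn2]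
    exact hasErrorExponent_minOuterChernoff hn (isFiniteDistribution_permUniform _)
  · rw [← minOuterChernoff_separateSampling μ₁ μ₂ hv hn2]
    exact hasErrorExponent_minOuterChernoff hn (isFiniteDistribution_separateSampling hn)
  · have hv' : (v : ℝ) ≠ 0 := NNReal.coe_ne_zero.2 hv
    have hn' : (n : ℝ) ≠ 0 := by exact_mod_cast (by omega : n ≠ 0)
    have hn1 : (n : ℝ) - 1 ≠ 0 := sub_ne_zero.2 (by exact_mod_cast (by omega : n ≠ 1))
    field_simp
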